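/- Let $\bar A=(A_0,A_1)$ be a compatible couple of quasi-Banach spaces (both continuously embedded in a Hausdorff topological vector space) with $A_0\cap A_1\neq\{0\}$. Let $K(t,f)=K(t,f;A_0,A_1)=\inf\{\|f_0\|_{A_0}+t\|f_1\|_{A_1}: f=f_0+f_1,\ f_i\in A_i\}$ for $f\in A_0+A_1$, $t>0$, and let $\|\cdot\|_{q,(c,d)}$ be the quasi-norm of $L_q(c,d)$, $0<q\le\infty$ (with $1/\infty=0$). A positive Lebesgue measurable function $b$ on $(0,\infty)$ is slowly varying, $b\in SV$, if for every $\varepsilon>0$ the function $t^{\varepsilon}b(t)$ is equivalent to a non-decreasing function and $t^{-\varepsilon}b(t)$ is equivalent to a non-increasing one ($f\approx g$ means that $C^{-1}g\le f\le Cg$ for some constant $C>0$). For $0\le\theta\le1$, $0<q,r,s\le\infty$ and positive functions $a,b,c$ on $(0,\infty)$, let $\bar A_{\theta,q;b}$, $\bar A^{\mathcal L}_{\theta,r,b,q,a}$ and $\bar A^{\mathcal L,\mathcal R}_{\theta,s,c,r,b,q,a}$ be the spaces of all $f\in A_0+A_1$ for which, respectively, the quasi-norms $$\|f\|_{\theta,q;b}=\big\|u^{-\theta-1/q}b(u)K(u,f)\big\|_{q,(0,\infty)},$$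 $$\Big\|t^{-1/r}b(t)\,\big\|u^{-\theta-1/q}a(u)K(u,f)\big\|_{q,(0,t)}\Big\|_{r,(0,\infty)},$$ $$\Big\|t^{-1/s}c(t)\,\Big\|u^{-1/r}b(u)\,\big\|v^{-\theta-1/q}a(v)K(v,f)\big\|_{q,(t,u)}\Big\|_{r,(t,\infty)}\Big\|_{s,(0,\infty)}$$ are finite; the same notation is used for other couples. For quasi-normed spaces, $X=Y$ means equality of sets with equivalent quasi-norms, and $X\cap Y$ carries the maximum of the two quasi-norms. Let $0<q_1,r_1\le\infty$ and $a_1,b_1\in SV$ with $$\big\|s^{-1/r_1}b_1(s)\big\|_{r_1,(1,\infty)}<\infty\quad\text{and}\quad \Big\|s^{-1/r_1}b_1(s)\,\big\|u^{-1/q_1}a_1(u)\big\|_{q_1,(0,s)}\Big\|_{r_1,(0,1)}<\infty,$$ and put, for $t>0$, $$\chi_1(t)=\Big\|s^{-1/r_1}b_1(s)\,\big\|u^{-1/q_1}a_1(u)\big\|_{q_1,(0,s)}\Big\|_{r_1,(0,t)}+\big\|s^{-1/r_1}b_1(s)\big\|_{r_1,(t,\infty)}\big\|u^{-1/q_1}a_1(u)\big\|_{q_1,(0,t)},\qquad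 \rho(t)=\frac{t}{\chi_1(t)}.$$ Let $0<r\le\infty$ and $a\in SV$. Then: (i) If $0<\theta<1$, then $(A_0,\bar A^{\mathcal L}_{1,r_1,b_1,q_1,a_1})_{\theta,r;a}=\bar A_{\theta,r;a^\#}$ with $a^\#=\chi_1^{\theta}\,(a\circ\rho)$. (ii) If $\|s^{-1/r}a(s)\|_{r,(1,\infty)}<\infty$, then $(A_0,\bar A^{\mathcal L}_{1,r_1,b_1,q_1,a_1})_{0,r;a}=\bar A_{0,r;a\circ\rho}$. (iii) If $\|s^{-1/r}a(s)\|_{r,(0,1)}<\infty$, then $(A_0,\bar A^{\mathcal L}_{1,r_1,b_1,q_1,a_1})_{1,r;a}=\bar A_{1,r;\chi_1\,(a\circ\rho)}\cap\bar A^{\mathcal L,\mathcal R}_{1,r,a\circ\rho,r_1,b_1,q_1,a_1}$. -/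

import Mathlib

open Set Filter Topology MeasureTheory
open scoped NNReal ENNReal

noncomputable section

namespace RealInterp

/-! ### Quasi-Banach spaces inside a topological vector space

A quasi-normed space `X` contained in a vector space `V` is given by its extended quasi-norm
`N : V → ℝ≥0∞`, with `X = {f | N f < ∞}`. -/

/-- `N` is the (extended) quasi-norm of a quasi-Banach space which is continuously embedded in
the topological vector space `V`. -/
structure IsQuasiBanach (𝕜 : Type*) {V : Type*} [RCLike 𝕜] [AddCommGroup V] [Module 𝕜 V]
    [TopologicalSpace V] (N : V → ℝ≥0∞) : Prop where
  eq_zero_iff : ∀ x, N x = 0 ↔ x = 0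
  smul : ∀ (c : 𝕜) (x : V), N (c • x) = ‖c‖ₑ * N x
  add_le : ∃ C : ℝ≥0, ∀ x y, N (x + y) ≤ C * (N x + N y)
  complete : ∀ u : ℕ → V, (∀ n, N (u n) < ∞) →
    (∀ ε : ℝ≥0∞, 0 < ε → ∃ n₀, ∀ m ≥ n₀, ∀ n ≥ n₀, N (u m - u n) < ε) →
    ∃ x, N x < ∞ ∧ Tendsto (fun n => N (u n - x)) atTop (𝓝 0)
  embed : Tendsto id (comap N (𝓝 0)) (𝓝 (0 : V))

/-- Continuous embedding `X ⊂ Y` of quasi-normed spaces. -/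
def Embedded {V : Type*} (NX NY : V → ℝ≥0∞) : Prop :=
  ∃ C : ℝ≥0, ∀ f, NX f < ∞ → NY f ≤ C * NX f

/-- `X = Y`: the same elements, and equivalent quasi-norms. -/
def SameSpace {V : Type*} (NX NY : V → ℝ≥0∞) : Prop :=
  Embedded NX NY ∧ Embedded NY NX

/-- The quasi-norm of the intersection `X ∩ Y`. -/
def interNorm {V : Type*} (NX NY : V → ℝ≥0∞) (f : V) : ℝ≥0∞ :=
  max (NX f) (NY f)

/-- Peetre's `K`-functional of the couple `(A₀, A₁)` with quasi-norms `N₀`, `N₁`, for `t > 0`.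
It is infinite exactly if `f ∉ A₀ + A₁`. -/
def peetreK {V : Type*} [AddCommGroup V] (N₀ N₁ : V → ℝ≥0∞) (t : ℝ) (f : V) : ℝ≥0∞ :=
  ⨅ (f₀ : V) (f₁ : V) (_ : f = f₀ + f₁), N₀ f₀ + ENNReal.ofReal t * N₁ f₁

/-! ### Slowly varying functions -/

/-- Equivalence `f ≈ g` of positive functions on `(0, ∞)`. -/
def EquivPos (f g : ℝ → ℝ) : Prop :=
  ∃ C : ℝ, 0 < C ∧ ∀ t, 0 < t → f t ≤ C * g t ∧ g t ≤ C * f t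

/-- `b` (restricted to `(0, ∞)`) is slowly varying; measurability is Lebesgue measurability. -/
structure IsSlowlyVarying (b : ℝ → ℝ) : Prop where
  pos : ∀ t, 0 < t → 0 < b t
  measurable : AEMeasurable b (volume.restrict (Ioi 0))
  incr : ∀ ε : ℝ, 0 < ε → ∃ g : ℝ → ℝ, (∀ t, 0 < t → 0 < g t) ∧ MonotoneOn g (Ioi 0) ∧
    EquivPos (fun t => t ^ ε * b t) g
  decr : ∀ ε : ℝ, 0 < ε → ∃ g : ℝ → ℝ, (∀ t, 0 < t → 0 < g t) ∧ AntitoneOn g (Ioi 0) ∧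
    EquivPos (fun t => t ^ (-ε) * b t) g

/-- The weighted norm `‖u ^ (σ - 1/q) b(u) F(u)‖` in `L_q(E)`, where `E ⊆ (0, ∞)` and
`1/∞ = 0`. -/
def wNorm (σ : ℝ) (q : ℝ≥0∞) (b : ℝ → ℝ) (E : Set ℝ) (F : ℝ → ℝ≥0∞) : ℝ≥0∞ :=
  eLpNorm (fun u => ENNReal.ofReal (u ^ (σ - (q⁻¹).toReal) * b u) * F u) q (volume.restrict E)

/-! ### Interpolation spaces

All of these quasi-norms are infinite outside `A₀ + A₁`, because there `K(·, f) = ∞`. -/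

section Spaces

variable {V : Type*} [AddCommGroup V]

/-- The quasi-norm of the standard space `(A₀, A₁)_{θ,q;b}`. -/
def stdNorm (N₀ N₁ : V → ℝ≥0∞) (θ : ℝ) (q : ℝ≥0∞) (b : ℝ → ℝ) (f : V) : ℝ≥0∞ :=
  wNorm (-θ) q b (Ioi 0) (fun u => peetreK N₀ N₁ u f)

/-- The quasi-norm of the limiting space `(A₀, A₁)^L_{θ,r,b,q,a}`. -/
def limLNorm (N₀ N₁ : V → ℝ≥0∞) (θ : ℝ) (r : ℝ≥0∞) (b : ℝ → ℝ) (q : ℝ≥0∞) (a : ℝ → ℝ)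
    (f : V) : ℝ≥0∞ :=
  wNorm 0 r b (Ioi 0) (fun t => wNorm (-θ) q a (Ioo 0 t) (fun u => peetreK N₀ N₁ u f))

/-- The quasi-norm of the extremal space `(A₀, A₁)^{L,R}_{θ,s,c,r,b,q,a}`. -/
def extLRNorm (N₀ N₁ : V → ℝ≥0∞) (θ : ℝ) (s : ℝ≥0∞) (c : ℝ → ℝ) (r : ℝ≥0∞) (b : ℝ → ℝ)
    (q : ℝ≥0∞) (a : ℝ → ℝ) (f : V) : ℝ≥0∞ :=
  wNorm 0 s c (Ioi 0) (fun t =>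
    wNorm 0 r b (Ioi t) (fun u =>
      wNorm (-θ) q a (Ioo t u) (fun v => peetreK N₀ N₁ v f)))

end Spaces

/-- `χ₁(t) = ‖s^(-1/r) b(s) ‖u^(-1/q) a(u)‖_{q,(0,s)}‖_{r,(0,t)}
+ ‖s^(-1/r) b(s)‖_{r,(t,∞)} ‖u^(-1/q) a(u)‖_{q,(0,t)}`, with values in `[0, ∞]`. -/
def chiExt (r : ℝ≥0∞) (b : ℝ → ℝ) (q : ℝ≥0∞) (a : ℝ → ℝ) (t : ℝ) : ℝ≥0∞ :=
  wNorm 0 r b (Ioo 0 t) (fun s => wNorm 0 q a (Ioo 0 s) (fun _ => 1)) +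
    wNorm 0 r b (Ioi t) (fun _ => 1) * wNorm 0 q a (Ioo 0 t) (fun _ => 1)

/-- `χ₁` as a real function; `chiExt` is finite and positive on `(0, ∞)` if the limiting space
`(A₀, A₁)^L_{1,r,b,q,a}` is nontrivial. -/
def chiFun (r : ℝ≥0∞) (b : ℝ → ℝ) (q : ℝ≥0∞) (a : ℝ → ℝ) (t : ℝ) : ℝ :=
  (chiExt r b q a t).toReal

/-- `ρ(t) = t / χ₁(t)`. -/
def rhoFun (r : ℝ≥0∞) (b : ℝ → ℝ) (q : ℝ≥0∞) (a : ℝ → ℝ) (t : ℝ) : ℝ :=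
  t / chiFun r b q a t

end RealInterp

end

/-! Write K(t,f) for the K-functional of (A₀, A₁), χ for a regularized χ₁ and ρ(t) = t/χ(t). Let
R(t,f) be the part of the limiting quasi-norm in which the inner variable exceeds t (`limTail`). The
core is a Holmstedt type formula for the couple formed by A₀ and the limiting space: K(ρ(t), f; A₀,
A₁^L) ≈ K(t,f) + ρ(t) R(t,f).

Lower half (`exists_le_peetreK_limLNorm`): let f = g₀ + g₁. The K-functional of g₀ is bounded by the
constant ‖g₀‖, and a constant T satisfies ρ(t) R(t,T) ≲ T because ρ grows almost linearly. For g₁,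
quasi-concavity gives K(t,g₁) ≤ ρ(t)‖g₁‖, since min(u,t) has limiting quasi-norm about χ(t). Upper
half (`exists_peetreK_limLNorm_le`): split f = f₀ + f₁ and put T = ‖f₀‖ + t‖f₁‖. Then K(u,f₁) ≤ uT/t
for u ≤ t and K(u,f₁) ≲ K(u,f) + T for u > t, so the limiting quasi-norm of f₁ is at most about
T/ρ(t) + R(t,f) + R(t,T).

The formula is inserted into the norm of the θ-space after the substitution u = ρ(t). As ρ is only
known up to equivalence, the substitution is a Tonelli argument on the relation "u and ρ(t) agree up
to a factor 4" (`exists_logNorm_comp_rhoReal`). This leaves a main part, the weighted norm of K, and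
a tail part, the weighted norm of ρR (`exists_stdNorm_limLNorm_equiv`).

For θ = 1 the powers of ρ in the tail part cancel and it becomes the (L,R)-norm; the main part has
weight χ/t times a∘ρ. For θ < 1 the weight ρ^(1-θ) a(ρ) grows like a power, so a Hardy type
inequality absorbs the tail part into the main part (`exists_tailPart_le`). -/

namespace RealInterp

/-! ### The measure `dt / t` -/

/-- The measure `dt / t` on `(0, ∞)`. -/
noncomputable def logMeasure : Measure ℝ :=
  (volume.restrict (Ioi 0)).withDensity (fun t => ENNReal.ofReal t⁻¹)

/-- The `L_q` quasi-norm over `E` with respect to `dt / t`. -/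
noncomputable def logNorm (q : ℝ≥0∞) (E : Set ℝ) (G : ℝ → ℝ≥0∞) : ℝ≥0∞ :=
  eLpNorm G q (logMeasure.restrict E)

theorem logMeasure_absolutelyContinuous : logMeasure ≪ volume.restrict (Ioi 0) :=
  withDensity_absolutelyContinuous _ _

theorem ae_pos_logMeasure : ∀ᵐ t ∂logMeasure, 0 < t :=
  logMeasure_absolutelyContinuous (ae_restrict_mem measurableSet_Ioi)

theorem measurable_ofReal_inv : Measurable (fun t : ℝ => ENNReal.ofReal t⁻¹) := by fun_prop

instance : NullSingletonClass logMeasure := by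
  unfold logMeasure; infer_instance

instance : SigmaFinite logMeasure := by
  unfold logMeasure
  infer_instance

theorem absolutelyContinuous_logMeasure : volume.restrict (Ioi 0) ≪ logMeasure := by
  refine withDensity_absolutelyContinuous' measurable_ofReal_inv.aemeasurable ?_
  filter_upwards [ae_restrict_mem measurableSet_Ioi] with t ht
  have : 0 < t := ht
  simp [this]

theorem ae_restrict_logMeasure {E : Set ℝ} (hE : MeasurableSet E) :
    ∀ᵐ t ∂logMeasure.restrict E, t ∈ E ∧ 0 < t := by
  filter_upwards [ae_restrict_mem hE, ae_restrict_of_ae ae_pos_logMeasure] with t h1 h2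
  exact ⟨h1, h2⟩

/-- The Jacobian 1/c of the dilation cancels against the density 1/t: dt/t is a Haar measure of the
multiplicative group. -/
theorem map_mul_left_logMeasure {c : ℝ} (hc : 0 < c) :
    logMeasure.map (c * ·) = logMeasure := by
  have hm : Measurable (fun t : ℝ => c * t) := by fun_prop
  ext s hs
  rw [Measure.map_apply hm hs, logMeasure, withDensity_apply _ (hm hs), withDensity_apply _ hs,
    Measure.restrict_restrict (hm hs), Measure.restrict_restrict hs,
    ← lintegral_indicator ((hm hs).inter measurableSet_Ioi),
    ← lintegral_indicator (hs.inter measurableSet_Ioi)]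
  set h : ℝ → ℝ≥0∞ := (s ∩ Ioi 0).indicator (fun t => ENNReal.ofReal t⁻¹) with hh
  have hmeas : Measurable h := measurable_ofReal_inv.indicator (hs.inter measurableSet_Ioi)
  have h1 : ∀ t, ((fun t => c * t) ⁻¹' s ∩ Ioi 0).indicator (fun t => ENNReal.ofReal t⁻¹) t
      = ENNReal.ofReal c * h (c * t) := by
    intro t
    by_cases ht : c * t ∈ s ∧ 0 < t
    · have h2 : t ∈ (fun t => c * t) ⁻¹' s ∩ Ioi 0 := ht
      have h3 : c * t ∈ s ∩ Ioi 0 := ⟨ht.1, mul_pos hc ht.2⟩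
      rw [indicator_of_mem h2, hh, indicator_of_mem h3, ← ENNReal.ofReal_mul hc.le, mul_inv,
        mul_inv_cancel_left₀ hc.ne']
    · have h2 : t ∉ (fun t => c * t) ⁻¹' s ∩ Ioi 0 := ht
      have h3 : c * t ∉ s ∩ Ioi 0 := fun h => ht ⟨h.1, (mul_pos_iff_of_pos_left hc).1 h.2⟩
      rw [indicator_of_notMem h2, hh, indicator_of_notMem h3, mul_zero]
  simp_rw [h1]
  rw [lintegral_const_mul (f := fun t => h (c * t)) _ (hmeas.comp hm), ← lintegral_map hmeas hm,
    Real.map_volume_mul_left hc.ne', lintegral_smul_measure, smul_eq_mul, ← mul_assoc,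
    ← ENNReal.ofReal_mul hc.le, abs_of_pos (inv_pos.2 hc), mul_inv_cancel₀ hc.ne',
    ENNReal.ofReal_one, one_mul]

theorem measurableEmbedding_mul_left {c : ℝ} (hc : 0 < c) :
    MeasurableEmbedding (fun t : ℝ => c * t) :=
  (Homeomorph.mulLeft₀ c hc.ne').measurableEmbedding

/-- Dilation invariance. -/
theorem logNorm_comp_mul (q : ℝ≥0∞) {E : Set ℝ} (G : ℝ → ℝ≥0∞) {c : ℝ}
    (hc : 0 < c) : logNorm q ((fun t => c * t) ⁻¹' E) (fun t => G (c * t)) = logNorm q E G := by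
  have he := measurableEmbedding_mul_left hc
  rw [logNorm, logNorm]
  conv_rhs => rw [← map_mul_left_logMeasure hc]
  rw [he.restrict_map, he.eLpNorm_map_measure]
  rfl

/-- The q-th power of u^(-1/q) is the density of dt/t. For q = ∞ this factor is absent, and the
essential suprema agree because the two measures have the same null sets in E. -/
theorem wNorm_eq_logNorm {σ : ℝ} {q : ℝ≥0∞} (hq : 0 < q) (b : ℝ → ℝ) {E : Set ℝ}
    (hE : MeasurableSet E) (hE0 : E ⊆ Ioi 0) (F : ℝ → ℝ≥0∞) :
    wNorm σ q b E F = logNorm q E (fun u => ENNReal.ofReal (u ^ σ * b u) * F u) := by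
  rw [wNorm, logNorm]
  have hr : logMeasure.restrict E = (volume.restrict E).withDensity
      (fun t => ENNReal.ofReal t⁻¹) := by
    rw [logMeasure, restrict_withDensity hE, Measure.restrict_restrict hE,
      inter_eq_left.2 hE0]
  have hpos : ∀ᵐ u ∂volume.restrict E, 0 < u := by
    filter_upwards [ae_restrict_mem hE] with u hu using hE0 hu
  rcases eq_or_ne q ∞ with rfl | hq'
  · simp only [eLpNorm_exponent_top, ENNReal.inv_top, ENNReal.toReal_zero, sub_zero,
      eLpNormEssSup]
    have h1 : logMeasure.restrict E ≪ volume.restrict E := by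
      rw [hr]; exact withDensity_absolutelyContinuous _ _
    have h2 : volume.restrict E ≪ logMeasure.restrict E := by
      rw [hr]
      refine withDensity_absolutelyContinuous' measurable_ofReal_inv.aemeasurable ?_
      filter_upwards [hpos] with t ht
      simp [ht]
    exact le_antisymm (essSup_mono_measure h2) (essSup_mono_measure h1)
  · have hq0 : 0 < q.toReal := ENNReal.toReal_pos hq.ne' hq'
    rw [eLpNorm_eq_lintegral_rpow_enorm_toReal hq.ne' hq',
      eLpNorm_eq_lintegral_rpow_enorm_toReal hq.ne' hq', hr,
      lintegral_withDensity_eq_lintegral_mul_non_measurable _ measurable_ofReal_inv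
        (Eventually.of_forall fun _ => ENNReal.ofReal_lt_top)]
    congr 1
    refine lintegral_congr_ae ?_
    filter_upwards [hpos] with u hu
    have h1 : ENNReal.ofReal (u ^ (σ - q⁻¹.toReal) * b u)
        = ENNReal.ofReal (u ^ (-q⁻¹.toReal)) * ENNReal.ofReal (u ^ σ * b u) := by
      rw [← ENNReal.ofReal_mul (Real.rpow_nonneg hu.le _), ← mul_assoc, ← Real.rpow_add hu]
      ring_nf
    simp only [enorm_eq_self, Pi.mul_apply]
    rw [h1, mul_assoc, ENNReal.mul_rpow_of_nonneg _ _ hq0.le,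
      ENNReal.ofReal_rpow_of_pos (Real.rpow_pos_of_pos hu _), ← Real.rpow_mul hu.le,
      ENNReal.toReal_inv, neg_mul, inv_mul_cancel₀ hq0.ne', Real.rpow_neg_one]

/-! ### Quasi-norm properties -/

variable {q : ℝ≥0∞} {E E' : Set ℝ} {F G : ℝ → ℝ≥0∞}

theorem logNorm_mono_set (h : E ⊆ E') : logNorm q E G ≤ logNorm q E' G :=
  eLpNorm_mono_measure _ (Measure.restrict_mono_set _ h)

theorem logNorm_le_mul (hE : MeasurableSet E) {c : ℝ≥0}
    (h : ∀ u ∈ E, 0 < u → F u ≤ c * G u) : logNorm q E F ≤ c * logNorm q E G := by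
  refine eLpNorm_le_mul_eLpNorm_of_ae_le_mul' ?_ q
  filter_upwards [ae_restrict_logMeasure hE] with u hu
  simpa using h u hu.1 hu.2

theorem logNorm_mono (hE : MeasurableSet E) (h : ∀ u ∈ E, 0 < u → F u ≤ G u) :
    logNorm q E F ≤ logNorm q E G := by
  simpa using logNorm_le_mul (c := 1) hE (by simpa using h)

theorem logNorm_congr (hE : MeasurableSet E) (h : ∀ u ∈ E, 0 < u → F u = G u) :
    logNorm q E F = logNorm q E G :=
  le_antisymm (logNorm_mono hE fun u h1 h2 => (h u h1 h2).le)
    (logNorm_mono hE fun u h1 h2 => (h u h1 h2).ge)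

/-- Unlike in `logNorm_le_mul`, the constant may be infinite; measurability of G is the price. -/
theorem logNorm_le_mul_of_aemeasurable (hE : MeasurableSet E) {c : ℝ≥0∞}
    (hG : AEMeasurable G logMeasure) (h : ∀ u ∈ E, 0 < u → F u ≤ c * G u) :
    logNorm q E F ≤ c * logNorm q E G := by
  refine eLpNorm_le_mul_eLpNorm_of_ae_le_mul'' q hG.restrict.aestronglyMeasurable ?_
  filter_upwards [ae_restrict_logMeasure hE] with u hu
  simpa using h u hu.1 hu.2

theorem logNorm_const_mul (hE : MeasurableSet E) {c : ℝ≥0∞} (hc : c ≠ 0) (hc' : c ≠ ∞) :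
    logNorm q E (fun u => c * G u) = c * logNorm q E G := by
  lift c to ℝ≥0 using hc'
  have hc0 : c ≠ 0 := by simpa using hc
  refine le_antisymm (logNorm_le_mul hE fun _ _ _ => le_rfl) ?_
  have h : logNorm q E G ≤ (c⁻¹ : ℝ≥0) * logNorm q E (fun u => c * G u) := by
    refine logNorm_le_mul hE fun u _ _ => ?_
    rw [← mul_assoc, ← ENNReal.coe_mul, inv_mul_cancel₀ hc0, ENNReal.coe_one, one_mul]
  calc (c : ℝ≥0∞) * logNorm q E G
      ≤ c * ((c⁻¹ : ℝ≥0) * logNorm q E (fun u => c * G u)) := by gcongr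
    _ = _ := by rw [← mul_assoc, ← ENNReal.coe_mul, mul_inv_cancel₀ hc0, ENNReal.coe_one, one_mul]

theorem exists_logNorm_add_le (q : ℝ≥0∞) : ∃ C : ℝ≥0, ∀ (E : Set ℝ) (F G : ℝ → ℝ≥0∞),
    AEMeasurable F logMeasure → AEMeasurable G logMeasure →
    logNorm q E (fun u => F u + G u) ≤ C * (logNorm q E F + logNorm q E G) := by
  refine ⟨(ENNReal.LpAddConst q).toNNReal, fun E F G hF hG => ?_⟩
  rw [ENNReal.coe_toNNReal (ENNReal.LpAddConst_lt_top q).ne]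
  exact eLpNorm_add_le' hF.restrict.aestronglyMeasurable hG.restrict.aestronglyMeasurable q

theorem logNorm_indicator (hE' : MeasurableSet E') :
    logNorm q E (E'.indicator G) = logNorm q (E' ∩ E) G := by
  rw [logNorm, eLpNorm_indicator_eq_eLpNorm_restrict hE', Measure.restrict_restrict hE', logNorm]

theorem exists_logNorm_union_le (q : ℝ≥0∞) : ∃ C : ℝ≥0, ∀ (E E' : Set ℝ) (G : ℝ → ℝ≥0∞),
    MeasurableSet E → MeasurableSet E' → AEMeasurable G logMeasure →
    logNorm q (E ∪ E') G ≤ C * (logNorm q E G + logNorm q E' G) := by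
  obtain ⟨C, hC⟩ := exists_logNorm_add_le q
  refine ⟨C, fun E E' G hE hE' hG => ?_⟩
  calc logNorm q (E ∪ E') G
      ≤ logNorm q (E ∪ E') (fun u => E.indicator G u + E'.indicator G u) := by
        refine logNorm_mono (hE.union hE') fun u hu _ => ?_
        rcases hu with hu | hu <;> simp [hu]
    _ ≤ C * (logNorm q (E ∪ E') (E.indicator G) + logNorm q (E ∪ E') (E'.indicator G)) :=
        hC _ _ _ (hG.indicator hE) (hG.indicator hE')
    _ = _ := by
        rw [logNorm_indicator hE, logNorm_indicator hE', inter_eq_left.2 subset_union_left,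
          inter_eq_left.2 subset_union_right]

theorem logNorm_Ioc {s t : ℝ} : logNorm q (Ioc s t) G = logNorm q (Ioo s t) G := by
  rw [logNorm, logNorm, Measure.restrict_congr_set Ioo_ae_eq_Ioc]

theorem logMeasure_Icc_lt_top {s t : ℝ} (hs : 0 < s) : logMeasure (Icc s t) < ∞ := by
  rw [logMeasure, withDensity_apply _ measurableSet_Icc,
    Measure.restrict_restrict measurableSet_Icc]
  calc ∫⁻ u in Icc s t ∩ Ioi 0, ENNReal.ofReal u⁻¹
      ≤ ∫⁻ _ in Icc s t ∩ Ioi 0, ENNReal.ofReal s⁻¹ := by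
        refine setLIntegral_mono measurable_const fun u hu => ?_
        exact ENNReal.ofReal_le_ofReal (inv_anti₀ hs hu.1.1)
    _ = ENNReal.ofReal s⁻¹ * volume (Icc s t ∩ Ioi 0) := by simp
    _ < ∞ := ENNReal.mul_lt_top ENNReal.ofReal_lt_top
        ((measure_mono inter_subset_left).trans_lt (by simp))

theorem logMeasure_Ioo_pos {s t : ℝ} (hs : 0 ≤ s) (hst : s < t) : 0 < logMeasure (Ioo s t) := by
  rw [pos_iff_ne_zero]
  intro h
  have h1 := absolutelyContinuous_logMeasure h
  rw [Measure.restrict_apply measurableSet_Ioo,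
    inter_eq_left.2 (show Ioo s t ⊆ Ioi 0 from fun u hu => hs.trans_lt hu.1)] at h1
  simp [hst.not_ge] at h1

theorem logMeasure_preimage_mul {c : ℝ} (hc : 0 < c) {s : Set ℝ} (hs : MeasurableSet s) :
    logMeasure ((fun t => c * t) ⁻¹' s) = logMeasure s := by
  conv_rhs => rw [← map_mul_left_logMeasure hc, Measure.map_apply (by fun_prop) hs]

theorem logNorm_const_pos (hq : 0 < q) {s t : ℝ} (hs : 0 ≤ s) (hst : s < t) :
    0 < logNorm q (Ioo s t) (fun _ => 1) := by
  have hne : logMeasure.restrict (Ioo s t) ≠ 0 := by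
    rw [Ne, Measure.restrict_eq_zero]; exact (logMeasure_Ioo_pos hs hst).ne'
  rw [logNorm, eLpNorm_const _ hq.ne' hne, Measure.restrict_apply_univ]
  simp only [enorm_eq_self, one_mul]
  have := logMeasure_Ioo_pos hs hst
  refine pos_iff_ne_zero.2 fun h => ?_
  rcases ENNReal.rpow_eq_zero_iff.1 h with h | h
  · exact this.ne' h.1
  · exact absurd h.2 (not_lt.2 (by positivity))

/-- The tail of a negative power. -/
theorem logNorm_rpow_Ioi_lt_top (hq : 0 < q) {δ : ℝ} (hδ : 0 < δ) :
    logNorm q (Ioi 1) (fun u => ENNReal.ofReal (u ^ (-δ))) < ∞ := by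
  rcases eq_or_ne q ∞ with rfl | hq'
  · have h : logNorm ∞ (Ioi 1) (fun u => ENNReal.ofReal (u ^ (-δ))) ≤ 1 := by
      rw [logNorm, eLpNorm_exponent_top]
      refine essSup_le_of_ae_le _ ?_
      filter_upwards [ae_restrict_mem measurableSet_Ioi] with u hu
      simp only [enorm_eq_self]
      exact ENNReal.ofReal_le_one.2 (Real.rpow_le_one_of_one_le_of_nonpos (le_of_lt hu)
        (by linarith))
    exact h.trans_lt ENNReal.one_lt_top
  · have hq0 : 0 < q.toReal := ENNReal.toReal_pos hq.ne' hq'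
    have hr : logMeasure.restrict (Ioi 1) = (volume.restrict (Ioi 1)).withDensity
        (fun t => ENNReal.ofReal t⁻¹) := by
      rw [logMeasure, restrict_withDensity measurableSet_Ioi,
        Measure.restrict_restrict measurableSet_Ioi, inter_eq_left.2 (Ioi_subset_Ioi zero_le_one)]
    rw [logNorm, eLpNorm_lt_top_iff_lintegral_rpow_enorm_lt_top hq.ne' hq', hr,
      lintegral_withDensity_eq_lintegral_mul_non_measurable _ measurable_ofReal_inv
        (Eventually.of_forall fun _ => ENNReal.ofReal_lt_top)]
    have hi := (integrableOn_Ioi_rpow_iff (s := -δ * q.toReal - 1) zero_lt_one).2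
      (by nlinarith [mul_pos hδ hq0])
    refine lt_of_eq_of_lt ?_ hi.2
    refine setLIntegral_congr_fun measurableSet_Ioi fun u hu => ?_
    have hu0 : 0 < u := zero_lt_one.trans hu
    simp only [Pi.mul_apply, enorm_eq_self]
    rw [ENNReal.ofReal_rpow_of_pos (Real.rpow_pos_of_pos hu0 _), ← Real.rpow_mul hu0.le,
      ← ENNReal.ofReal_mul (inv_nonneg.2 hu0.le), Real.enorm_of_nonneg (Real.rpow_nonneg hu0.le _),
      Real.rpow_sub_one hu0.ne', div_eq_mul_inv, mul_comm]

end RealInterp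

namespace RealInterp

/-! ### Slowly varying functions -/

/-- A positive function on `(0, ∞)` which changes at most like every small power. -/
structure HasSlowGrowth (b : ℝ → ℝ) : Prop where
  pos : ∀ t, 0 < t → 0 < b t
  growth : ∀ ε : ℝ, 0 < ε → ∃ C : ℝ, 0 < C ∧ ∀ s t, 0 < s → s ≤ t →
    b t ≤ C * (t / s) ^ ε * b s ∧ b s ≤ C * (t / s) ^ ε * b t

theorem IsSlowlyVarying.hasSlowGrowth {b : ℝ → ℝ} (hb : IsSlowlyVarying b) :
    HasSlowGrowth b := by
  refine ⟨hb.pos, fun ε hε => ?_⟩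
  obtain ⟨g, -, hg, C, hC, h⟩ := hb.incr ε hε
  obtain ⟨g', -, hg', C', hC', h'⟩ := hb.decr ε hε
  refine ⟨max (C * C) (C' * C'), lt_max_of_lt_left (by positivity), fun s t hs hst => ?_⟩
  have ht : 0 < t := hs.trans_le hst
  have hsε := Real.rpow_pos_of_pos hs ε
  have htε := Real.rpow_pos_of_pos ht ε
  have hbs := hb.pos s hs
  have hbt := hb.pos t ht
  rw [Real.div_rpow ht.le hs.le]
  constructor
  · have h1 : t ^ (-ε) * b t ≤ C' * (C' * (s ^ (-ε) * b s)) :=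
      (h' t ht).1.trans (mul_le_mul_of_nonneg_left
        ((hg' (mem_Ioi.2 hs) (mem_Ioi.2 ht) hst).trans (h' s hs).2) hC'.le)
    rw [Real.rpow_neg ht.le, Real.rpow_neg hs.le] at h1
    calc b t = t ^ ε * ((t ^ ε)⁻¹ * b t) := by field_simp
      _ ≤ t ^ ε * (C' * (C' * ((s ^ ε)⁻¹ * b s))) := by gcongr
      _ = C' * C' * (t ^ ε / s ^ ε) * b s := by field_simp
      _ ≤ _ := by gcongr; exact le_max_right _ _
  · have h1 : s ^ ε * b s ≤ C * (C * (t ^ ε * b t)) :=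
      (h s hs).1.trans (mul_le_mul_of_nonneg_left
        ((hg (mem_Ioi.2 hs) (mem_Ioi.2 ht) hst).trans (h t ht).2) hC.le)
    calc b s = (s ^ ε)⁻¹ * (s ^ ε * b s) := by field_simp
      _ ≤ (s ^ ε)⁻¹ * (C * (C * (t ^ ε * b t))) := by gcongr
      _ = C * C * (t ^ ε / s ^ ε) * b t := by field_simp
      _ ≤ _ := by gcongr; exact le_max_left _ _

theorem HasSlowGrowth.of_equivPos {b b' : ℝ → ℝ} (hb : HasSlowGrowth b)
    (hb' : ∀ t, 0 < t → 0 < b' t) (h : EquivPos b b') : HasSlowGrowth b' := by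
  refine ⟨hb', fun ε hε => ?_⟩
  obtain ⟨C, hC, h⟩ := h
  obtain ⟨D, hD, hg⟩ := hb.growth ε hε
  refine ⟨C * D * C, by positivity, fun s t hs hst => ?_⟩
  have ht : 0 < t := hs.trans_le hst
  have hp : 0 ≤ (t / s) ^ ε := by positivity
  constructor
  · calc b' t ≤ C * b t := (h t ht).2
      _ ≤ C * (D * (t / s) ^ ε * b s) := by gcongr; exact (hg s t hs hst).1
      _ ≤ C * (D * (t / s) ^ ε * (C * b' s)) := by gcongr; exact (h s hs).1
      _ = _ := by ring
  · calc b' s ≤ C * b s := (h s hs).2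
      _ ≤ C * (D * (t / s) ^ ε * b t) := by gcongr; exact (hg s t hs hst).2
      _ ≤ C * (D * (t / s) ^ ε * (C * b' t)) := by gcongr; exact (h t ht).1
      _ = _ := by ring

/-- A slowly varying function is equivalent to a Borel measurable one. -/
theorem IsSlowlyVarying.exists_measurable {b : ℝ → ℝ} (hb : IsSlowlyVarying b) :
    ∃ b' : ℝ → ℝ, Measurable b' ∧ HasSlowGrowth b' ∧ EquivPos b b' := by
  obtain ⟨g, hg0, hg, C, hC, h⟩ := hb.incr 1 one_pos
  -- g is monotone on (0,∞) only; composed with exp it is monotone on the whole line, hence Borel,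
  -- and log leads back.
  have hm : Monotone (fun x => g (Real.exp x)) := fun x y hxy =>
    hg (mem_Ioi.2 (Real.exp_pos x)) (mem_Ioi.2 (Real.exp_pos y)) (Real.exp_le_exp.2 hxy)
  have he : EquivPos b (fun t => t⁻¹ * g (Real.exp (Real.log t))) := by
    refine ⟨C, hC, fun t ht => ?_⟩
    have h1 := h t ht
    simp only [Real.rpow_one] at h1
    simp only [Real.exp_log ht]
    constructor
    · calc b t = t⁻¹ * (t * b t) := by field_simp
        _ ≤ t⁻¹ * (C * g t) := mul_le_mul_of_nonneg_left h1.1 (by positivity)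
        _ = _ := by ring
    · calc t⁻¹ * g t ≤ t⁻¹ * (C * (t * b t)) := mul_le_mul_of_nonneg_left h1.2 (by positivity)
        _ = _ := by field_simp
  refine ⟨_, ?_, hb.hasSlowGrowth.of_equivPos (fun t ht => ?_) he, he⟩
  · exact measurable_inv.mul (hm.measurable.comp Real.measurable_log)
  · have := hg0 _ (Real.exp_pos (Real.log t))
    positivity

theorem IsSlowlyVarying.aemeasurable_ofReal {b : ℝ → ℝ} (hb : IsSlowlyVarying b) :
    AEMeasurable (fun t => ENNReal.ofReal (b t)) logMeasure :=
  (hb.measurable.mono_ac logMeasure_absolutelyContinuous).ennreal_ofReal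

theorem HasSlowGrowth.ofReal_mul_le {b : ℝ → ℝ} (hb : HasSlowGrowth b) {ε : ℝ} (hε : 0 < ε) :
    ∃ C : ℝ, 0 < C ∧ ∀ l u, 1 ≤ l → 0 < u →
      ENNReal.ofReal (b (l * u)) ≤ ENNReal.ofReal (C * l ^ ε) * ENNReal.ofReal (b u) ∧
      ENNReal.ofReal (b u) ≤ ENNReal.ofReal (C * l ^ ε) * ENNReal.ofReal (b (l * u)) := by
  obtain ⟨C, hC, h⟩ := hb.growth ε hε
  refine ⟨C, hC, fun l u hl hu => ?_⟩
  have hl0 : 0 < l := zero_lt_one.trans_le hl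
  have h1 := h u (l * u) hu (le_mul_of_one_le_left hu.le hl)
  rw [mul_div_cancel_right₀ _ hu.ne'] at h1
  rw [← ENNReal.ofReal_mul (by positivity), ← ENNReal.ofReal_mul (by positivity)]
  exact ⟨ENNReal.ofReal_le_ofReal h1.1, ENNReal.ofReal_le_ofReal h1.2⟩

/-! ### The norms of slowly varying functions over `(0, t)` and `(t, ∞)` -/

/-- `‖u^(-1/q) a(u)‖_{q,(0,t)}`. -/
noncomputable def headNorm (q : ℝ≥0∞) (a : ℝ → ℝ) (t : ℝ) : ℝ≥0∞ :=
  logNorm q (Ioo 0 t) (fun u => ENNReal.ofReal (a u))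

/-- `‖u^(-1/q) a(u)‖_{q,(t,∞)}`. -/
noncomputable def tailNorm (q : ℝ≥0∞) (a : ℝ → ℝ) (t : ℝ) : ℝ≥0∞ :=
  logNorm q (Ioi t) (fun u => ENNReal.ofReal (a u))

section HeadTail

variable {q : ℝ≥0∞} {a : ℝ → ℝ}

theorem headNorm_mono : Monotone (headNorm q a) := fun _ _ h =>
  logNorm_mono_set (Ioo_subset_Ioo_right h)

theorem tailNorm_anti : Antitone (tailNorm q a) := fun _ _ h =>
  logNorm_mono_set (Ioi_subset_Ioi h)

/-- A dilation by l carries (0, t) to (0, lt) and replaces a(u) by a(lu), which slow growth compares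
with a(u). -/
theorem HasSlowGrowth.headNorm_mul_le (ha : HasSlowGrowth a) (q : ℝ≥0∞) {ε : ℝ} (hε : 0 < ε) :
    ∃ C : ℝ, 0 < C ∧ ∀ l t, 1 ≤ l →
      headNorm q a (l * t) ≤ ENNReal.ofReal (C * l ^ ε) * headNorm q a t := by
  obtain ⟨C, hC, h⟩ := ha.ofReal_mul_le hε
  refine ⟨C, hC, fun l t hl => ?_⟩
  have hl0 : 0 < l := zero_lt_one.trans_le hl
  rw [headNorm, headNorm, ← logNorm_comp_mul _ _ hl0]
  have he : (fun t => l * t) ⁻¹' Ioo 0 (l * t) = Ioo 0 t := by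
    ext u; simp [hl0, mul_div_cancel_left₀ _ hl0.ne']
  rw [he]
  exact logNorm_le_mul measurableSet_Ioo fun u _ hu => (h l u hl hu).1

theorem HasSlowGrowth.tailNorm_le_mul (ha : HasSlowGrowth a) (q : ℝ≥0∞) {ε : ℝ} (hε : 0 < ε) :
    ∃ C : ℝ, 0 < C ∧ ∀ l t, 1 ≤ l →
      tailNorm q a t ≤ ENNReal.ofReal (C * l ^ ε) * tailNorm q a (l * t) := by
  obtain ⟨C, hC, h⟩ := ha.ofReal_mul_le hε
  refine ⟨C, hC, fun l t hl => ?_⟩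
  have hl0 : 0 < l := zero_lt_one.trans_le hl
  rw [tailNorm, tailNorm, ← logNorm_comp_mul (E := Ioi (l * t)) _ _ hl0]
  have he : (fun t => l * t) ⁻¹' Ioi (l * t) = Ioi t := by
    ext u; simp [hl0, mul_div_cancel_left₀ _ hl0.ne']
  rw [he]
  exact logNorm_le_mul measurableSet_Ioi fun u _ hu => (h l u hl hu).2

/-- On (t/2, t) the function a is at least a multiple of a(t), and by dilation invariance the norm
of 1 over this interval does not depend on t. -/
theorem HasSlowGrowth.le_headNorm (ha : HasSlowGrowth a) (hq : 0 < q) :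
    ∃ C : ℝ≥0, ∀ t, 0 < t → ENNReal.ofReal (a t) ≤ C * headNorm q a t := by
  obtain ⟨C, hC, h⟩ := ha.growth 1 one_pos
  -- The minimum with 1 makes κ finite at once; only a positive lower bound matters.
  set κ : ℝ≥0∞ := min 1 (logNorm q (Ioo (1 / 2) 1) (fun _ => 1)) with hκ
  have hκ0 : κ ≠ 0 := (lt_min zero_lt_one
    (logNorm_const_pos hq (by norm_num) (by norm_num))).ne'
  have hκ1 : κ ≠ ∞ := ((min_le_left _ _).trans_lt ENNReal.one_lt_top).ne
  refine ⟨(κ⁻¹ * ENNReal.ofReal (C * 2)).toNNReal, fun t ht => ?_⟩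
  rw [ENNReal.coe_toNNReal (ENNReal.mul_ne_top (by simpa using hκ0) ENNReal.ofReal_ne_top)]
  have hat := ha.pos t ht
  have hd : logNorm q (Ioo (t / 2) t) (fun _ => 1) = logNorm q (Ioo (1 / 2) 1) (fun _ => 1) := by
    rw [← logNorm_comp_mul q (E := Ioo (t / 2) t) _ ht]
    congr 1
    ext u
    simp only [mem_preimage, mem_Ioo]
    rw [show t / 2 = t * (1 / 2) by ring, mul_lt_mul_iff_right₀ ht, mul_lt_iff_lt_one_right ht]
  have h1 : ENNReal.ofReal (a t) * κ ≤ ENNReal.ofReal (C * 2) * headNorm q a t :=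
    calc ENNReal.ofReal (a t) * κ
        ≤ ENNReal.ofReal (a t) * logNorm q (Ioo (t / 2) t) (fun _ => 1) := by
          rw [hd]; gcongr; exact min_le_right _ _
      _ = logNorm q (Ioo (t / 2) t) (fun _ => ENNReal.ofReal (a t) * 1) :=
          (logNorm_const_mul measurableSet_Ioo (by simpa using hat) ENNReal.ofReal_ne_top).symm
      _ ≤ ENNReal.ofReal (C * 2) * logNorm q (Ioo (t / 2) t) (fun u => ENNReal.ofReal (a u)) := by
          refine logNorm_le_mul measurableSet_Ioo fun u hu hu0 => ?_
          have h2 := (h u t hu0 hu.2.le).1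
          rw [mul_one]
          change _ ≤ ENNReal.ofReal (C * 2) * _
          rw [← ENNReal.ofReal_mul (by positivity)]
          refine ENNReal.ofReal_le_ofReal (h2.trans ?_)
          have := ha.pos u hu0
          rw [Real.rpow_one]
          gcongr
          rw [div_le_iff₀ hu0]; linarith [hu.1]
      _ ≤ _ := by
          gcongr
          exact logNorm_mono_set (Ioo_subset_Ioo_left (by positivity))
  calc ENNReal.ofReal (a t) = κ⁻¹ * (ENNReal.ofReal (a t) * κ) := by
        rw [mul_comm, mul_assoc, ENNReal.mul_inv_cancel hκ0 hκ1, mul_one]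
    _ ≤ κ⁻¹ * (ENNReal.ofReal (C * 2) * headNorm q a t) := by gcongr
    _ = _ := by rw [mul_assoc]

theorem HasSlowGrowth.headNorm_pos (ha : HasSlowGrowth a) (hq : 0 < q) {t : ℝ} (ht : 0 < t) :
    0 < headNorm q a t := by
  obtain ⟨C, hC⟩ := ha.le_headNorm hq
  refine pos_iff_ne_zero.2 fun h => ?_
  have := hC t ht
  rw [h, mul_zero, nonpos_iff_eq_zero, ENNReal.ofReal_eq_zero] at this
  exact (ha.pos t ht).not_ge this

theorem HasSlowGrowth.headNorm_lt_top (ha : HasSlowGrowth a) {s t : ℝ} (hs : 0 < s)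
    (h : headNorm q a s < ∞) : headNorm q a t < ∞ := by
  obtain ⟨C, hC, hl⟩ := ha.headNorm_mul_le q one_pos
  refine (headNorm_mono ?_).trans_lt ((hl (max 1 (t / s)) s (le_max_left _ _)).trans_lt
    (ENNReal.mul_lt_top ENNReal.ofReal_lt_top h))
  calc t = t / s * s := by field_simp
    _ ≤ _ := by gcongr; exact le_max_right _ _

theorem HasSlowGrowth.tailNorm_lt_top (ha : HasSlowGrowth a) {s t : ℝ} (ht : 0 < t)
    (h : tailNorm q a s < ∞) : tailNorm q a t < ∞ := by
  obtain ⟨C, hC, hl⟩ := ha.tailNorm_le_mul q one_pos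
  refine (hl (max 1 (s / t)) t (le_max_left _ _)).trans_lt
    (ENNReal.mul_lt_top ENNReal.ofReal_lt_top ((tailNorm_anti ?_).trans_lt h))
  calc s = s / t * t := by field_simp
    _ ≤ _ := by gcongr; exact le_max_right _ _

theorem HasSlowGrowth.tailNorm_pos (ha : HasSlowGrowth a) (hq : 0 < q) {t : ℝ} (ht : 0 < t) :
    0 < tailNorm q a t := by
  have h1 : 0 < headNorm q a (2 * t) := ha.headNorm_pos hq (by positivity)
  obtain ⟨C, hC, h⟩ := ha.growth 1 one_pos
  have hat := ha.pos t ht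
  have h2 : logNorm q (Ioo t (2 * t)) (fun _ => 1) ≤
      ENNReal.ofReal ((a t)⁻¹ * (C * 2)) * logNorm q (Ioo t (2 * t)) fun u => ENNReal.ofReal (a u) := by
    refine logNorm_le_mul measurableSet_Ioo fun u hu hu0 => ?_
    change _ ≤ ENNReal.ofReal _ * _
    have := (h t u ht hu.1.le).2
    have hau := ha.pos u hu0
    rw [← ENNReal.ofReal_mul (by positivity), ← ENNReal.ofReal_one]
    refine ENNReal.ofReal_le_ofReal ?_
    rw [Real.rpow_one] at this
    calc 1 = (a t)⁻¹ * a t := by field_simp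
      _ ≤ (a t)⁻¹ * (C * (u / t) * a u) := by gcongr
      _ ≤ (a t)⁻¹ * (C * 2 * a u) := by
        gcongr
        rw [div_le_iff₀ ht]; exact hu.2.le
      _ = _ := by ring
  refine pos_iff_ne_zero.2 fun h0 => ?_
  have h3 : logNorm q (Ioo t (2 * t)) (fun u => ENNReal.ofReal (a u)) = 0 :=
    le_antisymm ((logNorm_mono_set Ioo_subset_Ioi_self).trans h0.le) bot_le
  rw [h3, mul_zero] at h2
  exact (logNorm_const_pos hq ht.le (by linarith)).not_ge h2

end HeadTail

end RealInterp

namespace RealInterp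

/-! ### The functions `χ` and `ρ` -/

/-- A regularized version of `chiExt`: the quasi-norm in the limiting space with parameters
`r, b, q, a` of `u ↦ min u t`, with the factor `u⁻¹` absorbed. -/
noncomputable def chiReg (r : ℝ≥0∞) (b : ℝ → ℝ) (q : ℝ≥0∞) (a : ℝ → ℝ) (t : ℝ) : ℝ≥0∞ :=
  logNorm r (Ioi 0) (fun s => ENNReal.ofReal (b s) * headNorm q a (min s t))

/-- `chiReg` as a real function. -/
noncomputable def chiReal (r : ℝ≥0∞) (b : ℝ → ℝ) (q : ℝ≥0∞) (a : ℝ → ℝ) (t : ℝ) : ℝ :=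
  (chiReg r b q a t).toReal

/-- `t / χ(t)` for the regularized `χ`. -/
noncomputable def rhoReal (r : ℝ≥0∞) (b : ℝ → ℝ) (q : ℝ≥0∞) (a : ℝ → ℝ) (t : ℝ) : ℝ :=
  t / chiReal r b q a t

/-- Slowly varying weights for which the limiting space with these parameters is nontrivial. -/
structure LimitData (r : ℝ≥0∞) (b : ℝ → ℝ) (q : ℝ≥0∞) (a : ℝ → ℝ) : Prop where
  r_pos : 0 < r
  q_pos : 0 < q
  sv_b : IsSlowlyVarying b
  sv_a : IsSlowlyVarying a
  tail : tailNorm r b 1 < ∞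
  head : logNorm r (Ioo 0 1) (fun s => ENNReal.ofReal (b s) * headNorm q a s) < ∞

variable {r q : ℝ≥0∞} {b a : ℝ → ℝ}

/-- Monotonicity is visible in this form, whereas the sum in `chiExt` contains a decreasing factor.
-/
theorem chiReg_mono : Monotone (chiReg r b q a) := fun s t h =>
  logNorm_mono measurableSet_Ioi fun u _ _ => by
    gcongr
    exact headNorm_mono (min_le_min_left u h)

theorem measurable_rhoReal : Measurable (rhoReal r b q a) :=
  measurable_id.div (chiReg_mono.measurable.ennreal_toReal)

namespace LimitData

variable (h : LimitData r b q a)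
include h

/-- If the head norm were infinite at every positive point, the finite norm in `head` would have an
infinite integrand on (0,1). Finiteness at one point spreads by slow growth. -/
theorem headNorm_lt_top (t : ℝ) : headNorm q a t < ∞ := by
  by_cases H : ∃ s, 0 < s ∧ headNorm q a s < ∞
  · obtain ⟨s, hs, hs'⟩ := H
    exact h.sv_a.hasSlowGrowth.headNorm_lt_top hs hs'
  exfalso
  push Not at H
  have h1 : logNorm r (Ioo 0 1) (fun _ => ∞)
      ≤ logNorm r (Ioo 0 1) (fun s => ENNReal.ofReal (b s) * headNorm q a s) := by
    refine logNorm_mono measurableSet_Ioo fun u _ hu => ?_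
    rw [top_le_iff.1 (H u hu), ENNReal.mul_top (by simpa using h.sv_b.pos u hu)]
  have h2 : logNorm r (Ioo 0 1) (fun _ => ∞) = ∞ := by
    have hpos : 0 < logMeasure (Ioo 0 1) := logMeasure_Ioo_pos le_rfl zero_lt_one
    have hne : logMeasure.restrict (Ioo 0 1) ≠ 0 := by
      rw [Ne, Measure.restrict_eq_zero]; exact hpos.ne'
    rw [logNorm, eLpNorm_const _ h.r_pos.ne' hne, Measure.restrict_apply_univ, enorm_eq_self]
    refine ENNReal.top_mul fun h3 => ?_
    rcases ENNReal.rpow_eq_zero_iff.1 h3 with h3 | h3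
    · exact hpos.ne' h3.1
    · exact absurd h3.2 (not_lt.2 (by positivity))
  exact (h1.trans_lt h.head).ne h2

theorem headNorm_pos {t : ℝ} (ht : 0 < t) : 0 < headNorm q a t :=
  h.sv_a.hasSlowGrowth.headNorm_pos h.q_pos ht

theorem tailNorm_lt_top {t : ℝ} (ht : 0 < t) : tailNorm r b t < ∞ :=
  h.sv_b.hasSlowGrowth.tailNorm_lt_top ht h.tail

theorem tailNorm_pos {t : ℝ} (ht : 0 < t) : 0 < tailNorm r b t :=
  h.sv_b.hasSlowGrowth.tailNorm_pos h.r_pos ht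

theorem logNorm_tail_mul {t : ℝ} (ht : 0 < t) :
    logNorm r (Ioi t) (fun s => ENNReal.ofReal (b s) * headNorm q a (min s t))
      = tailNorm r b t * headNorm q a t := by
  rw [mul_comm, tailNorm, ← logNorm_const_mul measurableSet_Ioi (h.headNorm_pos ht).ne'
    (h.headNorm_lt_top t).ne]
  refine logNorm_congr measurableSet_Ioi fun u hu _ => ?_
  rw [min_eq_right (le_of_lt hu), mul_comm]

theorem chiExt_eq {t : ℝ} (ht : 0 < t) :
    chiExt r b q a t = logNorm r (Ioo 0 t) (fun s => ENNReal.ofReal (b s) * headNorm q a s)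
      + tailNorm r b t * headNorm q a t := by
  have h1 : ∀ s, 0 ≤ s → wNorm 0 q a (Ioo 0 s) (fun _ => 1) = headNorm q a s := fun s _ => by
    rw [wNorm_eq_logNorm h.q_pos _ measurableSet_Ioo Ioo_subset_Ioi_self, headNorm]
    simp
  rw [chiExt, h1 t ht.le, wNorm_eq_logNorm h.r_pos _ measurableSet_Ioo Ioo_subset_Ioi_self,
    wNorm_eq_logNorm h.r_pos _ measurableSet_Ioi (Ioi_subset_Ioi ht.le), tailNorm]
  simp only [Real.rpow_zero, one_mul, mul_one]
  congr 1
  refine logNorm_congr measurableSet_Ioo fun u _ hu => ?_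
  rw [h1 u hu.le]

theorem aemeasurable_weight : AEMeasurable (fun t => ENNReal.ofReal (b t)) logMeasure :=
  h.sv_b.aemeasurable_ofReal

theorem aemeasurable_chi (t : ℝ) :
    AEMeasurable (fun s => ENNReal.ofReal (b s) * headNorm q a (min s t)) logMeasure :=
  h.aemeasurable_weight.mul (Monotone.measurable fun _ _ huv =>
    headNorm_mono (min_le_min_right t huv)).aemeasurable

/-- Cutting the outer variable of `chiReg` at t gives the two summands of `chiExt`, since min(s,t)
is s before t and t after it. -/
theorem chiReg_equiv_chiExt : ∃ C : ℝ≥0, ∀ t, 0 < t →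
    chiReg r b q a t ≤ C * chiExt r b q a t ∧ chiExt r b q a t ≤ 2 * chiReg r b q a t := by
  obtain ⟨C, hC⟩ := exists_logNorm_union_le r
  refine ⟨C, fun t ht => ?_⟩
  have h1 : logNorm r (Ioo 0 t) (fun s => ENNReal.ofReal (b s) * headNorm q a s)
      = logNorm r (Ioc 0 t) (fun s => ENNReal.ofReal (b s) * headNorm q a (min s t)) := by
    rw [← logNorm_Ioc]
    refine logNorm_congr measurableSet_Ioc fun u hu _ => ?_
    rw [min_eq_left hu.2]
  rw [h.chiExt_eq ht, ← h.logNorm_tail_mul ht, h1]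
  constructor
  · rw [chiReg, ← Ioc_union_Ioi_eq_Ioi ht.le]
    exact hC _ _ _ measurableSet_Ioc measurableSet_Ioi (h.aemeasurable_chi t)
  · rw [two_mul]
    gcongr
    · exact logNorm_mono_set Ioc_subset_Ioi_self
    · exact logNorm_mono_set (Ioi_subset_Ioi ht.le)

/-- As min(u, lt) ≤ l min(u, t) for l ≥ 1, the slow growth of the head norm passes to χ. -/
theorem exists_chiReg_mul_le {ε : ℝ} (hε : 0 < ε) : ∃ C : ℝ, 0 < C ∧ ∀ l t, 1 ≤ l →
    chiReg r b q a (l * t) ≤ ENNReal.ofReal (C * l ^ ε) * chiReg r b q a t := by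
  obtain ⟨C, hC, hl⟩ := h.sv_a.hasSlowGrowth.headNorm_mul_le q hε
  refine ⟨C, hC, fun l t hl1 => ?_⟩
  refine logNorm_le_mul measurableSet_Ioi fun u hu hu0 => ?_
  change _ ≤ ENNReal.ofReal _ * _
  have h1 : headNorm q a (min u (l * t)) ≤ headNorm q a (l * min u t) := by
    refine headNorm_mono ?_
    rw [mul_min_of_nonneg _ _ (zero_le_one.trans hl1)]
    exact min_le_min_right _ (le_mul_of_one_le_left hu0.le hl1)
  calc ENNReal.ofReal (b u) * headNorm q a (min u (l * t))
      ≤ ENNReal.ofReal (b u) * (ENNReal.ofReal (C * l ^ ε) * headNorm q a (min u t)) := by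
        gcongr; exact h1.trans (hl l _ hl1)
    _ = _ := by rw [mul_left_comm]

theorem chiReg_lt_top (t : ℝ) : chiReg r b q a t < ∞ := by
  have h1 : chiReg r b q a 1 < ∞ := by
    obtain ⟨C, hC⟩ := h.chiReg_equiv_chiExt
    refine (hC 1 one_pos).1.trans_lt (ENNReal.mul_lt_top ENNReal.coe_lt_top ?_)
    rw [h.chiExt_eq one_pos]
    exact ENNReal.add_lt_top.2 ⟨h.head, ENNReal.mul_lt_top h.tail (h.headNorm_lt_top 1)⟩
  obtain ⟨C, hC, hl⟩ := h.exists_chiReg_mul_le one_pos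
  refine (chiReg_mono ?_).trans_lt ((hl (max 1 t) 1 (le_max_left _ _)).trans_lt
    (ENNReal.mul_lt_top ENNReal.ofReal_lt_top h1))
  rw [mul_one]; exact le_max_right _ _

theorem tail_mul_head_le {t : ℝ} (ht : 0 < t) :
    tailNorm r b t * headNorm q a t ≤ chiReg r b q a t := by
  rw [← h.logNorm_tail_mul ht]
  exact logNorm_mono_set (Ioi_subset_Ioi ht.le)

theorem chiReg_pos {t : ℝ} (ht : 0 < t) : 0 < chiReg r b q a t :=
  (ENNReal.mul_pos (h.tailNorm_pos ht).ne' (h.headNorm_pos ht).ne').trans_le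
    (h.tail_mul_head_le ht)

theorem chiReal_pos {t : ℝ} (ht : 0 < t) : 0 < chiReal r b q a t :=
  ENNReal.toReal_pos (h.chiReg_pos ht).ne' (h.chiReg_lt_top t).ne

theorem ofReal_chiReal (t : ℝ) :
    ENNReal.ofReal (chiReal r b q a t) = chiReg r b q a t :=
  ENNReal.ofReal_toReal (h.chiReg_lt_top t).ne

theorem chiReal_mono {s t : ℝ} (hst : s ≤ t) :
    chiReal r b q a s ≤ chiReal r b q a t :=
  ENNReal.toReal_mono (h.chiReg_lt_top t).ne (chiReg_mono hst)

theorem exists_chiReal_le {ε : ℝ} (hε : 0 < ε) : ∃ C : ℝ, 0 < C ∧ ∀ s t, 0 < s → s ≤ t →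
    chiReal r b q a t ≤ C * (t / s) ^ ε * chiReal r b q a s := by
  obtain ⟨C, hC, hl⟩ := h.exists_chiReg_mul_le hε
  refine ⟨C, hC, fun s t hs hst => ?_⟩
  have h1 := hl (t / s) s ((one_le_div₀ hs).2 hst)
  have ht : 0 < t := hs.trans_le hst
  rw [div_mul_cancel₀ _ hs.ne', ← h.ofReal_chiReal t, ← h.ofReal_chiReal s,
    ← ENNReal.ofReal_mul (by positivity)] at h1
  have := h.chiReal_pos hs
  exact (ENNReal.ofReal_le_ofReal_iff (by positivity)).1 h1

theorem chiReal_equiv_chiFun : EquivPos (chiReal r b q a) (chiFun r b q a) := by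
  obtain ⟨C, hC⟩ := h.chiReg_equiv_chiExt
  refine ⟨max C 2, by positivity, fun t ht => ?_⟩
  obtain ⟨h1, h2⟩ := hC t ht
  have hfin : chiExt r b q a t < ∞ :=
    h2.trans_lt (ENNReal.mul_lt_top (by simp) (h.chiReg_lt_top t))
  have h3 := ENNReal.toReal_mono (ENNReal.mul_lt_top ENNReal.coe_lt_top hfin).ne h1
  have h4 := ENNReal.toReal_mono (ENNReal.mul_lt_top (by simp) (h.chiReg_lt_top t)).ne h2
  rw [ENNReal.toReal_mul] at h3 h4
  have h5 : 0 ≤ chiFun r b q a t := ENNReal.toReal_nonneg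
  have h6 := h.chiReal_pos ht
  constructor
  · refine h3.trans ?_
    rw [ENNReal.coe_toReal]
    exact mul_le_mul_of_nonneg_right (le_max_left _ _) h5
  · refine h4.trans ?_
    rw [ENNReal.toReal_ofNat]
    exact mul_le_mul_of_nonneg_right (le_max_right _ _) h6.le

theorem chiFun_pos {t : ℝ} (ht : 0 < t) : 0 < chiFun r b q a t := by
  obtain ⟨C, hC, he⟩ := h.chiReal_equiv_chiFun
  exact pos_of_mul_pos_right ((h.chiReal_pos ht).trans_le (he t ht).1) hC.le

theorem rhoReal_pos {t : ℝ} (ht : 0 < t) : 0 < rhoReal r b q a t :=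
  div_pos ht (h.chiReal_pos ht)

theorem rhoReal_le {s t : ℝ} (hs : 0 < s) (hst : s ≤ t) :
    rhoReal r b q a t ≤ t / s * rhoReal r b q a s := by
  have ht : 0 < t := hs.trans_le hst
  have h1 := h.chiReal_pos hs
  rw [rhoReal, rhoReal, div_mul_div_cancel₀ hs.ne']
  gcongr
  exact h.chiReal_mono hst

/-- χ grows more slowly than every power, so ρ grows almost linearly. The case ε = 1 says that ρ is
increasing up to a constant. -/
theorem exists_le_rhoReal {ε : ℝ} (hε : 0 < ε) : ∃ C : ℝ, 0 < C ∧ ∀ s t, 0 < s → s ≤ t →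
    (t / s) ^ (1 - ε) * rhoReal r b q a s ≤ C * rhoReal r b q a t := by
  obtain ⟨C, hC, hc⟩ := h.exists_chiReal_le hε
  refine ⟨C, hC, fun s t hs hst => ?_⟩
  have ht : 0 < t := hs.trans_le hst
  have h1 := h.chiReal_pos hs
  have h2 := h.chiReal_pos ht
  have h3 : 0 < (t / s) ^ ε := by positivity
  rw [rhoReal, rhoReal, Real.rpow_sub (by positivity), Real.rpow_one, ← mul_div_assoc,
    ← mul_div_assoc, div_le_div_iff₀ h1 h2]
  calc t / s / (t / s) ^ ε * s * chiReal r b q a t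
      ≤ t / s / (t / s) ^ ε * s * (C * (t / s) ^ ε * chiReal r b q a s) := by
        gcongr; exact hc s t hs hst
    _ = _ := by field_simp

/-- The weight a is dominated by its head norm, and the product of tail and head is the part of χ
with s > t. -/
theorem exists_weight_mul_tail_le : ∃ C : ℝ≥0, ∀ t, 0 < t →
    ENNReal.ofReal (a t) * tailNorm r b t ≤ C * ENNReal.ofReal (chiReal r b q a t) := by
  obtain ⟨C, hC⟩ := h.sv_a.hasSlowGrowth.le_headNorm h.q_pos
  refine ⟨C, fun t ht => ?_⟩
  rw [h.ofReal_chiReal t]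
  calc ENNReal.ofReal (a t) * tailNorm r b t ≤ C * headNorm q a t * tailNorm r b t := by
        gcongr; exact hC t ht
    _ = C * (tailNorm r b t * headNorm q a t) := by ring
    _ ≤ _ := by gcongr; exact h.tail_mul_head_le ht

end LimitData

end RealInterp

namespace RealInterp

/-! ### The limiting functional and its tails -/

/-- The quasi-norm of the limiting space `(A₀, A₁)^L_{1,r,b,q,a}` in terms of `F = K(·, f)`. -/
noncomputable def limFun (r : ℝ≥0∞) (b : ℝ → ℝ) (q : ℝ≥0∞) (a : ℝ → ℝ) (F : ℝ → ℝ≥0∞) : ℝ≥0∞ :=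
  logNorm r (Ioi 0) (fun s => ENNReal.ofReal (b s) *
    logNorm q (Ioo 0 s) (fun u => ENNReal.ofReal (u⁻¹ * a u) * F u))

/-- The part of `limFun` where the inner variable is larger than `t`. -/
noncomputable def limTail (r : ℝ≥0∞) (b : ℝ → ℝ) (q : ℝ≥0∞) (a : ℝ → ℝ) (F : ℝ → ℝ≥0∞)
    (t : ℝ) : ℝ≥0∞ :=
  logNorm r (Ioi t) (fun s => ENNReal.ofReal (b s) *
    logNorm q (Ioo t s) (fun u => ENNReal.ofReal (u⁻¹ * a u) * F u))

variable {r q : ℝ≥0∞} {b a : ℝ → ℝ} {F G : ℝ → ℝ≥0∞}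

theorem limTail_anti : Antitone (limTail r b q a F) := fun _ _ h =>
  (logNorm_mono_set (Ioi_subset_Ioi h)).trans <| logNorm_mono measurableSet_Ioi fun _ _ _ => by
    gcongr
    exact logNorm_mono_set (Ioo_subset_Ioo_left h)

theorem limTail_le_limFun {t : ℝ} (ht : 0 ≤ t) : limTail r b q a F t ≤ limFun r b q a F :=
  (logNorm_mono_set (Ioi_subset_Ioi ht)).trans <| logNorm_mono measurableSet_Ioi fun _ _ _ => by
    gcongr
    exact logNorm_mono_set (Ioo_subset_Ioo_left ht)

theorem limTail_le_mul {c : ℝ≥0} {t : ℝ} (h : ∀ u, t < u → 0 < u → F u ≤ c * G u) :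
    limTail r b q a F t ≤ c * limTail r b q a G t := by
  refine logNorm_le_mul measurableSet_Ioi fun s _ _ => ?_
  rw [mul_left_comm]
  gcongr
  refine logNorm_le_mul measurableSet_Ioo fun u hu hu0 => ?_
  rw [mul_left_comm]
  gcongr
  exact h u hu.1 hu0

theorem measurable_logNorm_Ioo (q : ℝ≥0∞) (t : ℝ) (G : ℝ → ℝ≥0∞) :
    Measurable (fun s => logNorm q (Ioo t s) G) :=
  Monotone.measurable fun _ _ h => logNorm_mono_set (Ioo_subset_Ioo_right h)

theorem logNorm_rpow_Ioi (q : ℝ≥0∞) {δ t : ℝ} (ht : 0 < t) :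
    logNorm q (Ioi t) (fun u => ENNReal.ofReal ((t / u) ^ δ))
      = logNorm q (Ioi 1) (fun u => ENNReal.ofReal (u ^ (-δ))) := by
  rw [← logNorm_comp_mul q (E := Ioi t) _ ht]
  have he : (fun u => t * u) ⁻¹' Ioi t = Ioi 1 := by
    ext u; simp [ht, div_self ht.ne']
  rw [he]
  refine logNorm_congr measurableSet_Ioi fun u _ hu => ?_
  rw [div_mul_cancel_left₀ ht.ne', Real.inv_rpow hu.le, Real.rpow_neg hu.le]

namespace LimitData

variable (h : LimitData r b q a)
include h

theorem aemeasurable_weight_inner : AEMeasurable (fun u => ENNReal.ofReal (u⁻¹ * a u))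
    logMeasure :=
  (measurable_inv.aemeasurable.mul
    (h.sv_a.measurable.mono_ac logMeasure_absolutelyContinuous)).ennreal_ofReal

theorem exists_limTail_add_le : ∃ C : ℝ≥0, ∀ F G : ℝ → ℝ≥0∞, Measurable F → Measurable G → ∀ t,
    limTail r b q a (fun u => F u + G u) t ≤ C * (limTail r b q a F t + limTail r b q a G t) := by
  obtain ⟨C, hC⟩ := exists_logNorm_add_le q
  obtain ⟨D, hD⟩ := exists_logNorm_add_le r
  refine ⟨C * D, fun F G hF hG t => ?_⟩
  have hm : ∀ H : ℝ → ℝ≥0∞, AEMeasurable (fun s => ENNReal.ofReal (b s) *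
      logNorm q (Ioo t s) (fun u => ENNReal.ofReal (u⁻¹ * a u) * H u)) logMeasure := fun H =>
    h.aemeasurable_weight.mul (measurable_logNorm_Ioo q t _).aemeasurable
  calc limTail r b q a (fun u => F u + G u) t
      ≤ C * logNorm r (Ioi t) (fun s =>
          ENNReal.ofReal (b s) * logNorm q (Ioo t s) (fun u => ENNReal.ofReal (u⁻¹ * a u) * F u)
          + ENNReal.ofReal (b s) *
            logNorm q (Ioo t s) (fun u => ENNReal.ofReal (u⁻¹ * a u) * G u)) := by
        refine logNorm_le_mul measurableSet_Ioi fun s _ _ => ?_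
        rw [← mul_add, mul_left_comm]
        refine mul_le_mul' le_rfl ?_
        simp_rw [mul_add (ENNReal.ofReal (_ * _))]
        exact hC (Ioo t s) (fun u => ENNReal.ofReal (u⁻¹ * a u) * F u)
          (fun u => ENNReal.ofReal (u⁻¹ * a u) * G u)
          (h.aemeasurable_weight_inner.mul hF.aemeasurable)
          (h.aemeasurable_weight_inner.mul hG.aemeasurable)
    _ ≤ C * (D * (limTail r b q a F t + limTail r b q a G t)) := by
        gcongr
        exact hD _ _ _ (hm F) (hm G)
    _ = _ := by push_cast; ring

/-- A function which is `o(ρ)` with a power to spare has a controlled tail. -/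
theorem exists_limTail_le {ε : ℝ} (hε : 0 < ε) : ∃ C : ℝ≥0, ∀ (F : ℝ → ℝ≥0∞) (S : ℝ≥0∞) (t : ℝ),
    0 < t → (∀ u, t < u → F u ≤ S * ENNReal.ofReal ((t / u) ^ ε * rhoReal r b q a u)) →
    limTail r b q a F t ≤ C * S := by
  obtain ⟨C, hC⟩ := h.exists_weight_mul_tail_le
  -- Half of ε pays for replacing the tail norm of b at u by that at t; the other half keeps the
  -- inner norm finite.
  obtain ⟨D, hD, hDl⟩ := h.sv_b.hasSlowGrowth.tailNorm_le_mul r (half_pos hε)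
  set κ := logNorm q (Ioi 1) (fun u => ENNReal.ofReal (u ^ (-(ε / 2)))) with hκ
  have hκ' : κ ≠ ∞ := (logNorm_rpow_Ioi_lt_top h.q_pos (half_pos hε)).ne
  -- The summand 1 makes the constant nonzero, which settles S = ∞.
  refine ⟨C * D.toNNReal * κ.toNNReal + 1, fun F S t ht hF => ?_⟩
  rcases eq_or_ne S ∞ with rfl | hS
  · rw [ENNReal.mul_top (by simp)]
    exact le_top
  lift S to ℝ≥0 using hS
  have hB0 := (h.tailNorm_pos ht).ne'
  have hB1 := (h.tailNorm_lt_top ht).ne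
  set B := tailNorm r b t with hB
  have h1 : ∀ u, t < u → ENNReal.ofReal (u⁻¹ * a u) * F u
      ≤ (S * (C * D.toNNReal)) * B⁻¹ * ENNReal.ofReal ((t / u) ^ (ε / 2)) := fun u hu => by
    have hu0 : 0 < u := ht.trans hu
    have hau := h.sv_a.pos u hu0
    have hχ := h.chiReal_pos hu0
    have h2 : B ≤ ENNReal.ofReal (D * (u / t) ^ (ε / 2)) * tailNorm r b u := by
      have := hDl (u / t) t ((one_le_div₀ ht).2 hu.le)
      rwa [div_mul_cancel₀ _ ht.ne'] at this
    have h3 : ENNReal.ofReal (a u / chiReal r b q a u) * B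
        ≤ C * ENNReal.ofReal (D * (u / t) ^ (ε / 2)) := by
      calc ENNReal.ofReal (a u / chiReal r b q a u) * B
          ≤ ENNReal.ofReal (a u / chiReal r b q a u) *
            (ENNReal.ofReal (D * (u / t) ^ (ε / 2)) * tailNorm r b u) := by gcongr
        _ = ENNReal.ofReal (D * (u / t) ^ (ε / 2)) * (ENNReal.ofReal (chiReal r b q a u)⁻¹ *
            (ENNReal.ofReal (a u) * tailNorm r b u)) := by
          rw [div_eq_mul_inv, ENNReal.ofReal_mul hau.le]; ring
        _ ≤ ENNReal.ofReal (D * (u / t) ^ (ε / 2)) * (ENNReal.ofReal (chiReal r b q a u)⁻¹ *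
            (C * ENNReal.ofReal (chiReal r b q a u))) :=
          mul_le_mul' le_rfl (mul_le_mul' le_rfl (hC u hu0))
        _ = ENNReal.ofReal (D * (u / t) ^ (ε / 2)) * (C * (ENNReal.ofReal
            ((chiReal r b q a u)⁻¹ * chiReal r b q a u))) := by
          rw [ENNReal.ofReal_mul (inv_nonneg.2 hχ.le)]; ring
        _ = _ := by rw [inv_mul_cancel₀ hχ.ne', ENNReal.ofReal_one]; ring
    have h4 : ENNReal.ofReal (a u / chiReal r b q a u)
        ≤ C * ENNReal.ofReal (D * (u / t) ^ (ε / 2)) * B⁻¹ := by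
      rw [← div_eq_mul_inv, ENNReal.le_div_iff_mul_le (Or.inl hB0) (Or.inl hB1)]
      exact h3
    have h5 : u⁻¹ * a u * ((t / u) ^ ε * rhoReal r b q a u)
        = a u / chiReal r b q a u * (t / u) ^ ε := by
      rw [rhoReal]; field_simp
    have h6 : D * (u / t) ^ (ε / 2) * (t / u) ^ ε = D * (t / u) ^ (ε / 2) := by
      have h7 : (t / u) ^ ε = (t / u) ^ (ε / 2) * (t / u) ^ (ε / 2) := by
        rw [← Real.rpow_add (by positivity), add_halves]
      have h8 : (u / t) ^ (ε / 2) * (t / u) ^ (ε / 2) = 1 := by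
        rw [← Real.mul_rpow (by positivity) (by positivity), div_mul_div_cancel₀ ht.ne',
          div_self hu0.ne', Real.one_rpow]
      rw [h7, mul_assoc, ← mul_assoc (_ ^ _) (_ ^ _), h8, one_mul]
    calc ENNReal.ofReal (u⁻¹ * a u) * F u
        ≤ ENNReal.ofReal (u⁻¹ * a u) *
          (S * ENNReal.ofReal ((t / u) ^ ε * rhoReal r b q a u)) := by gcongr; exact hF u hu
      _ = S * (ENNReal.ofReal (a u / chiReal r b q a u) * ENNReal.ofReal ((t / u) ^ ε)) := by
          rw [mul_left_comm, ← ENNReal.ofReal_mul (by positivity), h5,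
            ENNReal.ofReal_mul (by positivity)]
      _ ≤ S * (C * ENNReal.ofReal (D * (u / t) ^ (ε / 2)) * B⁻¹ *
          ENNReal.ofReal ((t / u) ^ ε)) := by gcongr
      _ = S * (C * B⁻¹ * ENNReal.ofReal (D * (u / t) ^ (ε / 2) * (t / u) ^ ε)) := by
          rw [ENNReal.ofReal_mul (p := D * (u / t) ^ (ε / 2)) (by positivity)]; ring
      _ = _ := by
          rw [h6, ENNReal.ofReal_mul hD.le]
          simp only [ENNReal.ofReal]
          ring
  have hBi : B⁻¹ ≠ ∞ := by simpa using hB0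
  have h2 : ∀ s, logNorm q (Ioo t s) (fun u => ENNReal.ofReal (u⁻¹ * a u) * F u)
      ≤ (S * (C * D.toNNReal)) * B⁻¹ * κ := fun s => by
    calc logNorm q (Ioo t s) (fun u => ENNReal.ofReal (u⁻¹ * a u) * F u)
        ≤ logNorm q (Ioi t) (fun u => ENNReal.ofReal (u⁻¹ * a u) * F u) :=
          logNorm_mono_set Ioo_subset_Ioi_self
      _ ≤ (S * (C * D.toNNReal)) * B⁻¹ *
          logNorm q (Ioi t) (fun u => ENNReal.ofReal ((t / u) ^ (ε / 2))) := by
          refine logNorm_le_mul_of_aemeasurable measurableSet_Ioi ?_ fun u hu _ => h1 u hu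
          exact (Measurable.ennreal_ofReal (by fun_prop)).aemeasurable
      _ = _ := by rw [logNorm_rpow_Ioi q ht]
  -- The inner norms are bounded by a multiple of S/B for all s, and the outer norm of b over (t,∞)
  -- is exactly B.
  calc limTail r b q a F t
      ≤ (S * (C * D.toNNReal)) * B⁻¹ * κ * B := by
        refine logNorm_le_mul_of_aemeasurable measurableSet_Ioi h.aemeasurable_weight
          fun s _ _ => ?_
        rw [mul_comm]
        gcongr
        exact h2 s
    _ = C * D.toNNReal * κ * S * (B⁻¹ * B) := by ring
    _ = C * D.toNNReal * κ * S := by rw [ENNReal.inv_mul_cancel hB0 hB1, mul_one]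
    _ ≤ _ := by
        push_cast
        rw [ENNReal.coe_toNNReal hκ']
        gcongr
        exact le_self_add

/-- The limiting functional dominates the values of a quasi-concave function. -/
theorem le_rho_mul_limFun {t : ℝ} (ht : 0 < t)
    (hF : ∀ u, 0 < u → u ≤ t → ENNReal.ofReal u * F t ≤ ENNReal.ofReal t * F u) :
    F t ≤ ENNReal.ofReal (rhoReal r b q a t) * limFun r b q a F := by
  -- F(t) may be infinite; a finite nonzero c below it can be moved through the norms.
  refine ENNReal.le_of_forall_nnreal_lt fun c hc => ?_
  rcases eq_or_ne c 0 with rfl | hc0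
  · simp
  have hχ := h.chiReal_pos ht
  have ht0 : ENNReal.ofReal t ≠ 0 := by simpa using ht
  have hc0' : (c : ℝ≥0∞) ≠ 0 := by simpa using hc0
  -- Only the part (0, min(s,t)) of the inner interval is kept, where F(u) ≥ (u/t) F(t).
  have h1 : ∀ s, (c : ℝ≥0∞) * headNorm q a (min s t) ≤ ENNReal.ofReal t *
      logNorm q (Ioo 0 s) (fun u => ENNReal.ofReal (u⁻¹ * a u) * F u) := fun s => by
    rw [headNorm, ← logNorm_const_mul measurableSet_Ioo hc0' ENNReal.coe_ne_top,
      ← logNorm_const_mul measurableSet_Ioo ht0 ENNReal.ofReal_ne_top]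
    refine (logNorm_mono measurableSet_Ioo fun u hu hu0 => ?_).trans
      (logNorm_mono_set (Ioo_subset_Ioo_right (min_le_left s t)))
    have hau := h.sv_a.pos u hu0
    calc (c : ℝ≥0∞) * ENNReal.ofReal (a u)
        = ENNReal.ofReal (u⁻¹ * a u) * (ENNReal.ofReal u * c) := by
          rw [← mul_assoc, ← ENNReal.ofReal_mul (by positivity), mul_comm]
          congr 2; field_simp
      _ ≤ ENNReal.ofReal (u⁻¹ * a u) * (ENNReal.ofReal t * F u) := by
          refine mul_le_mul' le_rfl (le_trans ?_ (hF u hu0 (hu.2.le.trans (min_le_right _ _))))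
          gcongr
      _ = _ := by rw [mul_left_comm]
  have h2 : (c : ℝ≥0∞) * chiReg r b q a t ≤ ENNReal.ofReal t * limFun r b q a F := by
    rw [chiReg, limFun, ← logNorm_const_mul measurableSet_Ioi hc0' ENNReal.coe_ne_top,
      ← logNorm_const_mul measurableSet_Ioi ht0 ENNReal.ofReal_ne_top]
    refine logNorm_mono measurableSet_Ioi fun s _ _ => ?_
    rw [mul_left_comm, mul_left_comm (ENNReal.ofReal t)]
    exact mul_le_mul' le_rfl (h1 s)
  rw [rhoReal, ENNReal.ofReal_div_of_pos hχ, h.ofReal_chiReal t, ENNReal.div_eq_inv_mul,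
    mul_assoc, ← ENNReal.div_eq_inv_mul, ENNReal.le_div_iff_mul_le
      (Or.inl (h.chiReg_pos ht).ne') (Or.inl (h.chiReg_lt_top t).ne)]
  exact h2

/-- Upper bound of the limiting functional for a function which is linear up to `t`. -/
theorem exists_limFun_le : ∃ C : ℝ≥0, ∀ (F G : ℝ → ℝ≥0∞) (M : ℝ≥0) (t : ℝ), Measurable G →
    0 < t → (∀ u, 0 < u → u ≤ t → F u ≤ M * ENNReal.ofReal u) → (∀ u, t < u → F u ≤ G u) →
    limFun r b q a F ≤ C * (M * chiReg r b q a t + limTail r b q a G t) := by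
  obtain ⟨C, hC⟩ := exists_logNorm_add_le q
  obtain ⟨D, hD⟩ := exists_logNorm_add_le r
  refine ⟨C * D, fun F G M t hG ht h1 h2 => ?_⟩
  set W : ℝ → ℝ≥0∞ := fun u => ENNReal.ofReal (u⁻¹ * a u) * G u with hW
  have hWm : AEMeasurable W logMeasure := h.aemeasurable_weight_inner.mul hG.aemeasurable
  have ham := h.sv_a.aemeasurable_ofReal
  have h3 : ∀ s, logNorm q (Ioo 0 s) (fun u => ENNReal.ofReal (u⁻¹ * a u) * F u)
      ≤ C * (M * headNorm q a (min s t) + logNorm q (Ioo t s) W) := fun s => by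
    calc logNorm q (Ioo 0 s) (fun u => ENNReal.ofReal (u⁻¹ * a u) * F u)
        ≤ logNorm q (Ioo 0 s) (fun u => (Iic t).indicator (fun u => M * ENNReal.ofReal (a u)) u
            + (Ioi t).indicator W u) := by
          refine logNorm_mono measurableSet_Ioo fun u _ hu0 => ?_
          have hau := h.sv_a.pos u hu0
          rcases le_or_gt u t with hu | hu
          · rw [indicator_of_mem (mem_Iic.2 hu), indicator_of_notMem (notMem_Ioi.2 hu), add_zero]
            calc ENNReal.ofReal (u⁻¹ * a u) * F u
                ≤ ENNReal.ofReal (u⁻¹ * a u) * (M * ENNReal.ofReal u) := by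
                  gcongr; exact h1 u hu0 hu
              _ = M * (ENNReal.ofReal (u⁻¹ * a u) * ENNReal.ofReal u) := by ring
              _ = _ := by
                  rw [← ENNReal.ofReal_mul (by positivity)]; congr 2; field_simp
          · rw [indicator_of_notMem (notMem_Iic.2 hu), indicator_of_mem (mem_Ioi.2 hu), zero_add]
            simp only [hW]
            gcongr
            exact h2 u hu
      _ ≤ C * (logNorm q (Ioo 0 s) ((Iic t).indicator (fun u => M * ENNReal.ofReal (a u)))
            + logNorm q (Ioo 0 s) ((Ioi t).indicator W)) :=
          hC _ _ _ ((ham.const_mul _).indicator measurableSet_Iic)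
            (hWm.indicator measurableSet_Ioi)
      _ ≤ C * (M * headNorm q a (min s t) + logNorm q (Ioo t s) W) := by
          rw [logNorm_indicator measurableSet_Iic, logNorm_indicator measurableSet_Ioi]
          gcongr
          · have he : Iic t ∩ Ioo 0 s ⊆ Ioc 0 (min s t) := fun u hu =>
              ⟨hu.2.1, le_min hu.2.2.le hu.1⟩
            refine (logNorm_mono_set he).trans ?_
            rw [headNorm, ← logNorm_Ioc]
            exact logNorm_le_mul measurableSet_Ioc fun _ _ _ => le_rfl
          · exact logNorm_mono_set fun u hu => ⟨hu.1, hu.2.2⟩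
  have hm1 := (h.aemeasurable_chi t).const_mul (M : ℝ≥0∞)
  have hm2 : AEMeasurable (fun s => ENNReal.ofReal (b s) * logNorm q (Ioo t s) W) logMeasure :=
    h.aemeasurable_weight.mul (measurable_logNorm_Ioo q t _).aemeasurable
  calc limFun r b q a F
      ≤ C * logNorm r (Ioi 0) (fun s => M * (ENNReal.ofReal (b s) * headNorm q a (min s t))
          + (Ioi t).indicator (fun s => ENNReal.ofReal (b s) * logNorm q (Ioo t s) W) s) := by
        refine logNorm_le_mul measurableSet_Ioi fun s _ _ => ?_
        -- For s ≤ t the interval (t,s) is empty, so the indicator changes nothing.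
        have he : (Ioi t).indicator (fun s => ENNReal.ofReal (b s) * logNorm q (Ioo t s) W) s
            = ENNReal.ofReal (b s) * logNorm q (Ioo t s) W := by
          rcases le_or_gt s t with hs | hs
          · rw [indicator_of_notMem (notMem_Ioi.2 hs), Ioo_eq_empty hs.not_gt]
            simp [logNorm]
          · rw [indicator_of_mem (mem_Ioi.2 hs)]
        rw [he, mul_left_comm (M : ℝ≥0∞), ← mul_add, mul_left_comm]
        gcongr
        exact h3 s
    _ ≤ C * (D * (M * chiReg r b q a t + limTail r b q a G t)) := by
        gcongr
        refine (hD _ _ _ hm1 (hm2.indicator measurableSet_Ioi)).trans ?_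
        gcongr
        · exact logNorm_le_mul measurableSet_Ioi fun _ _ _ => le_rfl
        · rw [logNorm_indicator measurableSet_Ioi]
          exact logNorm_mono_set inter_subset_left
    _ = _ := by push_cast; ring

end LimitData

end RealInterp

namespace RealInterp

/-! ### The `K`-functional -/

section Peetre

variable {V : Type*} [AddCommGroup V] {N₀ N₁ : V → ℝ≥0∞}

theorem peetreK_le {t : ℝ} {f f₀ f₁ : V} (h : f = f₀ + f₁) :
    peetreK N₀ N₁ t f ≤ N₀ f₀ + ENNReal.ofReal t * N₁ f₁ :=
  iInf_le_of_le f₀ (iInf_le_of_le f₁ (iInf_le _ h))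

theorem le_peetreK {t : ℝ} {f : V} {x : ℝ≥0∞}
    (h : ∀ f₀ f₁, f = f₀ + f₁ → x ≤ N₀ f₀ + ENNReal.ofReal t * N₁ f₁) :
    x ≤ peetreK N₀ N₁ t f :=
  le_iInf fun f₀ => le_iInf fun f₁ => le_iInf fun hf => h f₀ f₁ hf

theorem peetreK_mono (f : V) : Monotone (fun t => peetreK N₀ N₁ t f) := fun s t h => by
  refine le_peetreK fun f₀ f₁ hf => (peetreK_le hf).trans ?_
  gcongr

theorem measurable_peetreK (f : V) : Measurable (fun t => peetreK N₀ N₁ t f) :=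
  (peetreK_mono f).measurable

theorem ofReal_mul_peetreK_le {s t : ℝ} (h : s ≤ t) (f : V) :
    ENNReal.ofReal s * peetreK N₀ N₁ t f ≤ ENNReal.ofReal t * peetreK N₀ N₁ s f := by
  rcases le_or_gt t 0 with ht | ht
  · simp [ENNReal.ofReal_of_nonpos (h.trans ht)]
  have ht0 : ENNReal.ofReal t ≠ 0 := by simpa using ht
  rw [mul_comm (ENNReal.ofReal t), ← ENNReal.div_le_iff_le_mul (Or.inl ht0)
    (Or.inl ENNReal.ofReal_ne_top)]
  refine le_peetreK fun f₀ f₁ hf => ?_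
  rw [ENNReal.div_le_iff_le_mul (Or.inl ht0) (Or.inl ENNReal.ofReal_ne_top)]
  calc ENNReal.ofReal s * peetreK N₀ N₁ t f
      ≤ ENNReal.ofReal s * (N₀ f₀ + ENNReal.ofReal t * N₁ f₁) :=
        mul_le_mul' le_rfl (peetreK_le hf)
    _ = ENNReal.ofReal s * N₀ f₀ + ENNReal.ofReal s * N₁ f₁ * ENNReal.ofReal t := by ring
    _ ≤ ENNReal.ofReal t * N₀ f₀ + ENNReal.ofReal s * N₁ f₁ * ENNReal.ofReal t := by gcongr
    _ = _ := by ring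

/-- The quasi-concavity of the `K`-functional. -/
theorem peetreK_le_mul {s t c : ℝ} (hc : 1 ≤ c) (h : t ≤ c * s) (f : V) :
    peetreK N₀ N₁ t f ≤ ENNReal.ofReal c * peetreK N₀ N₁ s f := by
  have hc0 : ENNReal.ofReal c ≠ 0 := by simpa using zero_lt_one.trans_le hc
  rw [mul_comm, ← ENNReal.div_le_iff_le_mul (Or.inl hc0) (Or.inl ENNReal.ofReal_ne_top)]
  refine le_peetreK fun f₀ f₁ hf => ?_
  rw [ENNReal.div_le_iff_le_mul (Or.inl hc0) (Or.inl ENNReal.ofReal_ne_top)]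
  calc peetreK N₀ N₁ t f ≤ N₀ f₀ + ENNReal.ofReal t * N₁ f₁ := peetreK_le hf
    _ ≤ ENNReal.ofReal c * N₀ f₀ + (ENNReal.ofReal c * ENNReal.ofReal s) * N₁ f₁ := by
        rw [← ENNReal.ofReal_mul (by positivity)]
        gcongr
        exact le_mul_of_one_le_left' (by simpa using hc)
    _ = _ := by ring

theorem peetreK_le_left (h₁ : N₁ 0 = 0) (t : ℝ) (f : V) : peetreK N₀ N₁ t f ≤ N₀ f := by
  simpa [h₁] using peetreK_le (N₀ := N₀) (N₁ := N₁) (t := t) (add_zero f).symm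

theorem peetreK_le_right (h₀ : N₀ 0 = 0) (t : ℝ) (f : V) :
    peetreK N₀ N₁ t f ≤ ENNReal.ofReal t * N₁ f := by
  simpa [h₀] using peetreK_le (N₀ := N₀) (N₁ := N₁) (t := t) (zero_add f).symm

theorem le_mul_peetreK {t : ℝ} {f : V} {x : ℝ≥0∞} {c : ℝ≥0}
    (h : ∀ f₀ f₁, f = f₀ + f₁ → x ≤ c * (N₀ f₀ + ENNReal.ofReal t * N₁ f₁)) :
    x ≤ c * peetreK N₀ N₁ t f := by
  rcases eq_or_ne c 0 with rfl | hc
  · simpa using h f 0 (add_zero f).symm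
  have hc' : (c : ℝ≥0∞) ≠ 0 := by simpa using hc
  rw [mul_comm, ← ENNReal.div_le_iff_le_mul (Or.inl hc') (Or.inl ENNReal.coe_ne_top)]
  refine le_peetreK fun f₀ f₁ hf => ?_
  rw [ENNReal.div_le_iff_le_mul (Or.inl hc') (Or.inl ENNReal.coe_ne_top), mul_comm]
  exact h f₀ f₁ hf

/-- Truncated subtraction moves y to the left, so that the infimum can be taken in one summand while
the other stays fixed. -/
theorem le_peetreK_add {t : ℝ} {f : V} {x y : ℝ≥0∞}
    (h : ∀ f₀ f₁, f = f₀ + f₁ → x ≤ (N₀ f₀ + ENNReal.ofReal t * N₁ f₁) + y) :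
    x ≤ peetreK N₀ N₁ t f + y :=
  tsub_le_iff_right.1 (le_peetreK fun f₀ f₁ hf => tsub_le_iff_right.2 (h f₀ f₁ hf))

theorem exists_peetreK_add_le (h₀ : ∃ C : ℝ≥0, ∀ x y, N₀ (x + y) ≤ C * (N₀ x + N₀ y))
    (h₁ : ∃ C : ℝ≥0, ∀ x y, N₁ (x + y) ≤ C * (N₁ x + N₁ y)) :
    ∃ C : ℝ≥0, ∀ t x y, peetreK N₀ N₁ t (x + y) ≤ C * (peetreK N₀ N₁ t x + peetreK N₀ N₁ t y) := by
  obtain ⟨C, hC⟩ := h₀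
  obtain ⟨D, hD⟩ := h₁
  -- The summand 1 makes the constant nonzero, so that it can be divided away before the infima are
  -- taken.
  refine ⟨max C D + 1, fun t x y => ?_⟩
  have hc : ((max C D + 1 : ℝ≥0) : ℝ≥0∞) ≠ 0 := by simp
  have hle₀ : (C : ℝ≥0∞) ≤ (max C D + 1 : ℝ≥0) := by
    exact_mod_cast (le_max_left C D).trans le_self_add
  have hle₁ : (D : ℝ≥0∞) ≤ (max C D + 1 : ℝ≥0) := by
    exact_mod_cast (le_max_right C D).trans le_self_add
  rw [mul_comm, ← ENNReal.div_le_iff_le_mul (Or.inl hc) (Or.inl ENNReal.coe_ne_top)]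
  refine le_peetreK_add fun x₀ x₁ hx => ?_
  rw [add_comm (N₀ x₀ + _)]
  refine le_peetreK_add fun y₀ y₁ hy => ?_
  rw [ENNReal.div_le_iff_le_mul (Or.inl hc) (Or.inl ENNReal.coe_ne_top)]
  calc peetreK N₀ N₁ t (x + y) ≤ N₀ (x₀ + y₀) + ENNReal.ofReal t * N₁ (x₁ + y₁) :=
        peetreK_le (by rw [hx, hy]; abel)
    _ ≤ (max C D + 1 : ℝ≥0) * (N₀ x₀ + N₀ y₀)
        + ENNReal.ofReal t * ((max C D + 1 : ℝ≥0) * (N₁ x₁ + N₁ y₁)) :=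
        add_le_add ((hC _ _).trans (mul_le_mul' hle₀ le_rfl))
          (mul_le_mul' le_rfl ((hD _ _).trans (mul_le_mul' hle₁ le_rfl)))
    _ = _ := by ring

end Peetre

/-! ### A Holmstedt type formula for the couple of A₀ and the limiting space. -/

section Holmstedt

variable {𝕜 V : Type*} [RCLike 𝕜] [AddCommGroup V] {N₀ N₁ : V → ℝ≥0∞} {r q : ℝ≥0∞} {b a : ℝ → ℝ}

theorem LimitData.limLNorm_eq (h : LimitData r b q a) (f : V) :
    limLNorm N₀ N₁ 1 r b q a f = limFun r b q a (fun t => peetreK N₀ N₁ t f) := by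
  rw [limLNorm, wNorm_eq_logNorm h.r_pos _ measurableSet_Ioi subset_rfl, limFun]
  refine logNorm_congr measurableSet_Ioi fun s _ _ => ?_
  rw [wNorm_eq_logNorm h.q_pos _ measurableSet_Ioo Ioo_subset_Ioi_self]
  simp only [Real.rpow_zero, one_mul, Real.rpow_neg_one]

/-- Since ρ grows at least like a square root up to a constant, T ≲ (T/ρ(t)) (t/u)^(1/2) ρ(u) for u
> t, which is the input of `exists_limTail_le`. -/
theorem LimitData.exists_rho_mul_limTail_const_le (h : LimitData r b q a) :
    ∃ C : ℝ≥0, ∀ (T : ℝ≥0∞) (t : ℝ), 0 < t →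
      ENNReal.ofReal (rhoReal r b q a t) * limTail r b q a (fun _ => T) t ≤ C * T := by
  obtain ⟨L, hL⟩ := h.exists_limTail_le (ε := 1 / 2) (by norm_num)
  obtain ⟨R, hR, hRl⟩ := h.exists_le_rhoReal (ε := 1 / 2) (by norm_num)
  refine ⟨L * R.toNNReal, fun T t ht => ?_⟩
  have hρ := h.rhoReal_pos ht
  have h1 := hL (fun _ => T) (T * ENNReal.ofReal (R / rhoReal r b q a t)) t ht fun u hu => by
    have hu0 := ht.trans hu
    have h2 := hRl t u ht hu.le
    rw [mul_assoc, ← ENNReal.ofReal_mul (by positivity)]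
    refine le_mul_of_one_le_right' (ENNReal.one_le_ofReal.2 ?_)
    rw [show (1 : ℝ) - 1 / 2 = 1 / 2 by norm_num] at h2
    have h3 : (u / t) ^ (1 / 2 : ℝ) * (t / u) ^ (1 / 2 : ℝ) = 1 := by
      rw [← Real.mul_rpow (by positivity) (by positivity), div_mul_div_cancel₀ ht.ne',
        div_self hu0.ne', Real.one_rpow]
    calc 1 = (rhoReal r b q a t)⁻¹ * (t / u) ^ (1 / 2 : ℝ) *
          ((u / t) ^ (1 / 2 : ℝ) * rhoReal r b q a t) := by
          rw [show ∀ x y z w : ℝ, x * y * (z * w) = (z * y) * (x * w) by intros; ring, h3,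
            inv_mul_cancel₀ hρ.ne', one_mul]
      _ ≤ (rhoReal r b q a t)⁻¹ * (t / u) ^ (1 / 2 : ℝ) * (R * rhoReal r b q a u) := by
          gcongr
      _ = _ := by rw [div_eq_mul_inv]; ring
  calc ENNReal.ofReal (rhoReal r b q a t) * limTail r b q a (fun _ => T) t
      ≤ ENNReal.ofReal (rhoReal r b q a t) *
        (L * (T * ENNReal.ofReal (R / rhoReal r b q a t))) := mul_le_mul' le_rfl h1
    _ = L * T * (ENNReal.ofReal (rhoReal r b q a t) * ENNReal.ofReal (R / rhoReal r b q a t)) := by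
        ring
    _ = L * T * ENNReal.ofReal R := by
        rw [← ENNReal.ofReal_mul hρ.le, mul_div_cancel₀ _ hρ.ne']
    _ = _ := by push_cast [ENNReal.ofReal]; ring

variable [Module 𝕜 V] [TopologicalSpace V]

theorem IsQuasiBanach.map_zero {N : V → ℝ≥0∞} (hN : IsQuasiBanach 𝕜 N) : N 0 = 0 :=
  (hN.eq_zero_iff 0).2 rfl

theorem IsQuasiBanach.map_neg {N : V → ℝ≥0∞} (hN : IsQuasiBanach 𝕜 N) (x : V) :
    N (-x) = N x := by
  simpa using hN.smul (-1) x

/-- The lower half of the Holmstedt type formula for the couple `(A₀, A₁^L)`. -/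
theorem LimitData.exists_le_peetreK_limLNorm (h : LimitData r b q a)
    (hN₀ : IsQuasiBanach 𝕜 N₀) (hN₁ : IsQuasiBanach 𝕜 N₁) : ∃ C : ℝ≥0, ∀ t, 0 < t → ∀ f : V,
      peetreK N₀ N₁ t f + ENNReal.ofReal (rhoReal r b q a t) *
        limTail r b q a (fun u => peetreK N₀ N₁ u f) t ≤
      C * peetreK N₀ (limLNorm N₀ N₁ 1 r b q a) (rhoReal r b q a t) f := by
  obtain ⟨C, hC⟩ := exists_peetreK_add_le hN₀.add_le hN₁.add_le
  obtain ⟨D, hD⟩ := h.exists_limTail_add_le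
  obtain ⟨L, hL⟩ := h.exists_rho_mul_limTail_const_le
  refine ⟨C + C * D * (L + 1), fun t ht f => le_mul_peetreK fun g₀ g₁ hg => ?_⟩
  rw [h.limLNorm_eq]
  set ρ := ENNReal.ofReal (rhoReal r b q a t)
  set J := limFun r b q a (fun u => peetreK N₀ N₁ u g₁)
  -- The bound is uniform in u, so the tail of g₀ is at most the tail of a constant.
  have hg₀ : ∀ u, peetreK N₀ N₁ u g₀ ≤ N₀ g₀ := fun u => peetreK_le_left hN₁.map_zero u g₀
  have h1 : peetreK N₀ N₁ t f ≤ C * (N₀ g₀ + ρ * J) := by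
    rw [hg]
    refine (hC t g₀ g₁).trans (mul_le_mul' le_rfl (add_le_add (hg₀ t) ?_))
    exact h.le_rho_mul_limFun ht fun u _ hut => ofReal_mul_peetreK_le hut g₁
  have h2 : ρ * limTail r b q a (fun u => peetreK N₀ N₁ u f) t
      ≤ C * D * (L + 1) * (N₀ g₀ + ρ * J) := by
    calc ρ * limTail r b q a (fun u => peetreK N₀ N₁ u f) t
        ≤ ρ * (C * limTail r b q a (fun u => peetreK N₀ N₁ u g₀ + peetreK N₀ N₁ u g₁) t) := by
          refine mul_le_mul' le_rfl (limTail_le_mul fun u _ _ => ?_)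
          rw [hg]; exact hC u g₀ g₁
      _ ≤ ρ * (C * (D * (limTail r b q a (fun u => peetreK N₀ N₁ u g₀) t
            + limTail r b q a (fun u => peetreK N₀ N₁ u g₁) t))) := by
          refine mul_le_mul' le_rfl (mul_le_mul' le_rfl ?_)
          exact hD _ _ (measurable_peetreK g₀) (measurable_peetreK g₁) t
      _ = C * D * (ρ * limTail r b q a (fun u => peetreK N₀ N₁ u g₀) t
            + ρ * limTail r b q a (fun u => peetreK N₀ N₁ u g₁) t) := by ring
      _ ≤ C * D * (L * N₀ g₀ + ρ * J) := by
          refine mul_le_mul' le_rfl (add_le_add ?_ (mul_le_mul' le_rfl (limTail_le_limFun ht.le)))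
          refine le_trans (mul_le_mul' le_rfl ?_) (hL (N₀ g₀) t ht)
          simpa using limTail_le_mul (c := 1) (r := r) (b := b) (q := q) (a := a) (t := t)
            (G := fun _ => N₀ g₀) fun u _ _ => by simpa using hg₀ u
      _ ≤ C * D * ((L + 1) * N₀ g₀ + (L + 1) * (ρ * J)) := by
          refine mul_le_mul' le_rfl (add_le_add (mul_le_mul' le_self_add le_rfl) ?_)
          exact le_mul_of_one_le_left' le_add_self
      _ = _ := by ring
  calc _ ≤ C * (N₀ g₀ + ρ * J) + C * D * (L + 1) * (N₀ g₀ + ρ * J) := add_le_add h1 h2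
    _ = _ := by push_cast; ring

/-- The upper half of the Holmstedt type formula for the couple `(A₀, A₁^L)`. -/
theorem LimitData.exists_peetreK_limLNorm_le (h : LimitData r b q a)
    (hN₀ : IsQuasiBanach 𝕜 N₀) (hN₁ : IsQuasiBanach 𝕜 N₁) : ∃ C : ℝ≥0, ∀ t, 0 < t → ∀ f : V,
      peetreK N₀ (limLNorm N₀ N₁ 1 r b q a) (rhoReal r b q a t) f ≤
      C * (peetreK N₀ N₁ t f + ENNReal.ofReal (rhoReal r b q a t) *
        limTail r b q a (fun u => peetreK N₀ N₁ u f) t) := by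
  obtain ⟨C, hC⟩ := exists_peetreK_add_le hN₀.add_le hN₁.add_le
  obtain ⟨D, hD⟩ := h.exists_limTail_add_le
  obtain ⟨L, hL⟩ := h.exists_rho_mul_limTail_const_le
  obtain ⟨M, hM⟩ := h.exists_limFun_le
  set A : ℝ≥0 := 1 + M * (1 + C * D * (L + 1)) with hA
  have hA0 : (A : ℝ≥0∞) ≠ 0 := by simp [hA]
  refine ⟨A, fun t ht f => ?_⟩
  rw [mul_comm, ← ENNReal.div_le_iff_le_mul (Or.inl hA0) (Or.inl ENNReal.coe_ne_top)]
  refine le_peetreK_add fun f₀ f₁ hf => ?_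
  rw [ENNReal.div_le_iff_le_mul (Or.inl hA0) (Or.inl ENNReal.coe_ne_top), mul_comm]
  rcases eq_or_ne (N₀ f₀ + ENNReal.ofReal t * N₁ f₁) ∞ with hT | hT
  · rw [hT, top_add, ENNReal.mul_top hA0]; exact le_top
  obtain ⟨T, hT'⟩ : ∃ T : ℝ≥0, (T : ℝ≥0∞) = _ := ⟨_, ENNReal.coe_toNNReal hT⟩
  rw [← hT']
  have hρ0 := h.rhoReal_pos ht
  have hχ := h.chiReal_pos ht
  set ρ := ENNReal.ofReal (rhoReal r b q a t) with hρ
  set Rf := limTail r b q a (fun u => peetreK N₀ N₁ u f) t with hRf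
  have hf₀ : N₀ f₀ ≤ T := by rw [hT']; exact le_self_add
  have ht0 : ENNReal.ofReal t ≠ 0 := by simpa using ht
  have hf₁ : N₁ f₁ ≤ (T / t.toNNReal : ℝ≥0) := by
    rw [ENNReal.coe_div (by simpa using ht)]
    change N₁ f₁ ≤ T / ENNReal.ofReal t
    rw [ENNReal.le_div_iff_mul_le (Or.inl ht0) (Or.inl ENNReal.coe_ne_top), hT', mul_comm]
    exact le_add_self
  have hmK := measurable_peetreK (N₀ := N₀) (N₁ := N₁) f
  -- Up to t the K-functional of f₁ is at most linear with slope T/t; beyond t, f₁ = f + (-f₀)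
  -- bounds it by C(K(u,f) + T).
  have h1 := hM (fun u => peetreK N₀ N₁ u f₁) (fun u => C * (peetreK N₀ N₁ u f + T))
    (T / t.toNNReal) t ((hmK.add_const _).const_mul _) ht
    (fun u _ _ => (peetreK_le_right hN₀.map_zero u f₁).trans (by
      rw [mul_comm]; exact mul_le_mul' hf₁ le_rfl))
    (fun u _ => by
      have h2 := hC u f (-f₀)
      rw [hf, add_neg_cancel_comm] at h2
      refine h2.trans (mul_le_mul' le_rfl (add_le_add (by rw [hf]) ?_))
      exact (peetreK_le_left hN₁.map_zero u _).trans ((hN₀.map_neg f₀).trans_le hf₀))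
  have h2 : limTail r b q a (fun u => C * (peetreK N₀ N₁ u f + T)) t
      ≤ C * (D * (Rf + limTail r b q a (fun _ => T) t)) :=
    (limTail_le_mul fun _ _ _ => le_rfl).trans
      (mul_le_mul' le_rfl (hD _ _ hmK measurable_const t))
  -- The choice of ρ enters here: ρ(t) χ(t) = t.
  have h3 : ρ * ((T / t.toNNReal : ℝ≥0) * chiReg r b q a t) = T := by
    rw [← h.ofReal_chiReal t, mul_left_comm, hρ, ← ENNReal.ofReal_mul hρ0.le, rhoReal,
      div_mul_cancel₀ _ hχ.ne', ENNReal.coe_div (by simpa using ht)]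
    exact ENNReal.div_mul_cancel ht0 ENNReal.ofReal_ne_top
  calc peetreK N₀ (limLNorm N₀ N₁ 1 r b q a) (rhoReal r b q a t) f
      ≤ N₀ f₀ + ρ * limLNorm N₀ N₁ 1 r b q a f₁ := peetreK_le hf
    _ ≤ T + ρ * (M * ((T / t.toNNReal : ℝ≥0) * chiReg r b q a t +
          C * (D * (Rf + limTail r b q a (fun _ => T) t)))) := by
        rw [h.limLNorm_eq]
        exact add_le_add hf₀ (mul_le_mul' le_rfl (h1.trans (mul_le_mul' le_rfl
          (add_le_add le_rfl h2))))
    _ = T + M * (ρ * ((T / t.toNNReal : ℝ≥0) * chiReg r b q a t) +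
          C * D * (ρ * Rf + ρ * limTail r b q a (fun _ => T) t)) := by ring
    _ ≤ T + M * (T + C * D * (ρ * Rf + L * T)) := by
        rw [h3]
        exact add_le_add le_rfl (mul_le_mul' le_rfl (add_le_add le_rfl (mul_le_mul' le_rfl
          (add_le_add le_rfl (hL T t ht)))))
    -- The added terms complete the product A(T + ρ Rf).
    _ ≤ T + M * (T + C * D * (ρ * Rf + L * T)) + ρ * Rf + M * (ρ * Rf + C * D * (L * (ρ * Rf) + T)) := by
        rw [add_assoc]
        exact le_self_add
    _ = _ := by rw [hA]; push_cast; ring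

end Holmstedt

end RealInterp

namespace RealInterp

/-! ### Comparison of norms by Tonelli's theorem -/

theorem logNorm_Ioi_zero (s : ℝ≥0∞) (G : ℝ → ℝ≥0∞) :
    logNorm s (Ioi 0) G = eLpNorm G s logMeasure := by
  have h : ∀ᵐ t ∂logMeasure, t ∈ Ioi (0 : ℝ) := ae_pos_logMeasure
  rw [logNorm, Measure.restrict_eq_self_of_ae_mem h]

theorem le_logNorm_top_of_slice {H : ℝ → ℝ≥0∞} {x : ℝ≥0∞} {c : ℝ≥0} {Z : Set ℝ}
    (hZ : logMeasure Z ≠ 0) (h : ∀ t ∈ Z, x ≤ c * H t) : x ≤ c * logNorm ∞ (Ioi 0) H := by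
  rw [logNorm_Ioi_zero, eLpNorm_exponent_top]
  by_contra hx
  refine hZ (measure_mono_null (fun t ht => ?_)
    (ae_iff.1 (enorm_ae_le_eLpNormEssSup H logMeasure)))
  intro hle
  exact hx ((h t ht).trans (mul_le_mul' le_rfl hle))

/-- If a relation `Z` has slices of measure bounded from below in one direction and from above in
the other, then pointwise estimates along `Z` imply estimates of norms. -/
theorem exists_logNorm_le_of_slices {s : ℝ≥0∞} (hs : 0 < s) {Z : Set (ℝ × ℝ)}
    (hZ : MeasurableSet Z) {m m' : ℝ≥0∞} (hm : m ≠ 0) (hm_top : m ≠ ∞) (hm' : m' ≠ ∞)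
    (hlow : ∀ u, 0 < u → m ≤ logMeasure {t | (u, t) ∈ Z})
    (hup : ∀ t, 0 < t → logMeasure {u | (u, t) ∈ Z} ≤ m') :
    ∃ C : ℝ≥0, ∀ (c : ℝ≥0) (G H : ℝ → ℝ≥0∞), Measurable H →
      (∀ u t, (u, t) ∈ Z → G u ≤ c * H t) →
      logNorm s (Ioi 0) G ≤ C * c * logNorm s (Ioi 0) H := by
  rcases eq_or_ne s ∞ with rfl | hs'
  · refine ⟨1, fun c G H hH h => ?_⟩
    rw [ENNReal.coe_one, one_mul, logNorm_Ioi_zero _ G, eLpNorm_exponent_top]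
    refine essSup_le_of_ae_le _ ?_
    filter_upwards [ae_pos_logMeasure] with u hu
    -- For s = ∞ only the positive measure of the slices is needed: each contains a point where H is
    -- at most its essential supremum.
    exact le_logNorm_top_of_slice ((pos_iff_ne_zero.2 hm).trans_le (hlow u hu)).ne'
      fun t ht => h u t ht
  set p := s.toReal with hp
  have hp0 : 0 < p := ENNReal.toReal_pos hs.ne' hs'
  have hfin : (m⁻¹ * m') ^ (1 / p) ≠ ∞ :=
    ENNReal.rpow_ne_top_of_nonneg (by positivity)
      (ENNReal.mul_ne_top (by simpa using hm) hm')
  refine ⟨((m⁻¹ * m') ^ (1 / p)).toNNReal, fun c G H hH h => ?_⟩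
  rw [ENNReal.coe_toNNReal hfin, logNorm_Ioi_zero, logNorm_Ioi_zero,
    eLpNorm_eq_lintegral_rpow_enorm_toReal hs.ne' hs',
    eLpNorm_eq_lintegral_rpow_enorm_toReal hs.ne' hs', ← hp]
  simp only [enorm_eq_self]
  -- (cH)^p is integrated over Z in both orders: slices at fixed u are bounded below by m, those at
  -- fixed t above by m'.
  have h1 : m * ∫⁻ u, G u ^ p ∂logMeasure ≤ m' * ((c : ℝ≥0∞) ^ p * ∫⁻ t, H t ^ p ∂logMeasure) :=
    calc m * ∫⁻ u, G u ^ p ∂logMeasure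
        = ∫⁻ u, m * G u ^ p ∂logMeasure := (lintegral_const_mul' _ _ hm_top).symm
      _ ≤ ∫⁻ u, ∫⁻ t, Z.indicator (fun z => (c * H z.2) ^ p) (u, t) ∂logMeasure
          ∂logMeasure := by
          refine lintegral_mono_ae ?_
          filter_upwards [ae_pos_logMeasure] with u hu
          have hZu : MeasurableSet {t | (u, t) ∈ Z} := measurable_prodMk_left hZ
          calc m * G u ^ p ≤ logMeasure {t | (u, t) ∈ Z} * G u ^ p := by
                gcongr; exact hlow u hu
            _ = ∫⁻ _ in {t | (u, t) ∈ Z}, G u ^ p ∂logMeasure := by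
                rw [setLIntegral_const, mul_comm]
            _ ≤ ∫⁻ t in {t | (u, t) ∈ Z}, (c * H t) ^ p ∂logMeasure := by
                refine setLIntegral_mono' hZu fun t ht => ?_
                gcongr
                exact h u t ht
            _ = ∫⁻ t, {t | (u, t) ∈ Z}.indicator (fun t => (c * H t) ^ p) t ∂logMeasure :=
                (lintegral_indicator hZu _).symm
            _ = _ := rfl
      _ = ∫⁻ t, ∫⁻ u, Z.indicator (fun z => (c * H z.2) ^ p) (u, t) ∂logMeasure
          ∂logMeasure := by
          refine lintegral_lintegral_swap (Measurable.aemeasurable ?_)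
          exact Measurable.indicator (by fun_prop) hZ
      _ ≤ ∫⁻ t, m' * ((c : ℝ≥0∞) ^ p * H t ^ p) ∂logMeasure := by
          refine lintegral_mono_ae ?_
          filter_upwards [ae_pos_logMeasure] with t ht
          have hZt : MeasurableSet {u | (u, t) ∈ Z} := measurable_prodMk_right hZ
          calc ∫⁻ u, Z.indicator (fun z => (c * H z.2) ^ p) (u, t) ∂logMeasure
              = ∫⁻ u, {u | (u, t) ∈ Z}.indicator (fun _ => (c * H t) ^ p) u ∂logMeasure := rfl
            _ = (c * H t) ^ p * logMeasure {u | (u, t) ∈ Z} := by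
                rw [lintegral_indicator hZt, setLIntegral_const]
            _ ≤ (c * H t) ^ p * m' := by gcongr; exact hup t ht
            _ = _ := by rw [ENNReal.mul_rpow_of_nonneg _ _ hp0.le, mul_comm]
      _ = _ := by
          rw [lintegral_const_mul' _ _ hm', lintegral_const_mul' _ _
            (ENNReal.rpow_ne_top_of_nonneg hp0.le ENNReal.coe_ne_top)]
  have h2 : ∫⁻ u, G u ^ p ∂logMeasure
      ≤ m⁻¹ * m' * ((c : ℝ≥0∞) ^ p * ∫⁻ t, H t ^ p ∂logMeasure) := by
    calc ∫⁻ u, G u ^ p ∂logMeasure = m⁻¹ * (m * ∫⁻ u, G u ^ p ∂logMeasure) := by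
          rw [← mul_assoc, ENNReal.inv_mul_cancel hm hm_top, one_mul]
      _ ≤ m⁻¹ * (m' * ((c : ℝ≥0∞) ^ p * ∫⁻ t, H t ^ p ∂logMeasure)) := by gcongr
      _ = _ := by rw [mul_assoc]
  calc (∫⁻ u, G u ^ p ∂logMeasure) ^ (1 / p)
      ≤ (m⁻¹ * m' * ((c : ℝ≥0∞) ^ p * ∫⁻ t, H t ^ p ∂logMeasure)) ^ (1 / p) := by gcongr
    _ = _ := by
        rw [ENNReal.mul_rpow_of_nonneg (m⁻¹ * m') _ (by positivity),
          ENNReal.mul_rpow_of_nonneg (_ ^ p) _ (by positivity), ← ENNReal.rpow_mul,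
          mul_one_div_cancel hp0.ne', ENNReal.rpow_one, mul_assoc]

theorem logMeasure_Icc_mul {c s t : ℝ} (hc : 0 < c) :
    logMeasure (Icc (c * s) (c * t)) = logMeasure (Icc s t) := by
  rw [← logMeasure_preimage_mul hc measurableSet_Icc]
  congr 1
  ext u
  simp [hc, mul_div_cancel_left₀ _ hc.ne']

theorem logMeasure_Ioo_mul {c s t : ℝ} (hc : 0 < c) :
    logMeasure (Ioo (c * s) (c * t)) = logMeasure (Ioo s t) := by
  rw [← logMeasure_preimage_mul hc measurableSet_Ioo]
  congr 1
  ext u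
  simp [hc, mul_div_cancel_left₀ _ hc.ne']

/-! ### The change of variables by ρ and a Hardy type inequality. -/

variable {r q : ℝ≥0∞} {b a : ℝ → ℝ}

namespace LimitData

variable (h : LimitData r b q a)
include h

/-- The values of `ρ` on `(0, ∞)` come close to every positive number. -/
theorem exists_rhoReal_near {u : ℝ} (hu : 0 < u) : ∃ T, 0 < T ∧ ∀ t ∈ Ioo T (2 * T),
    u ≤ rhoReal r b q a t ∧ rhoReal r b q a t ≤ 4 * u := by
  obtain ⟨R, hR, hRl⟩ := h.exists_le_rhoReal (ε := 1 / 2) (by norm_num)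
  have h1 : 0 < rhoReal r b q a 1 := h.rhoReal_pos one_pos
  rw [show (1 : ℝ) - 1 / 2 = 1 / 2 by norm_num] at hRl
  simp only [← Real.sqrt_eq_rpow] at hRl
  -- The supremum T of this set replaces a solution of ρ(t) = u, so that no continuity of ρ is
  -- needed. The square root growth makes the set nonempty and bounded.
  set S := {t : ℝ | 0 < t ∧ rhoReal r b q a t ≤ u} with hS
  have hne : S.Nonempty := by
    set x := R * rhoReal r b q a 1 / u with hx
    have hx0 : 0 < x := by positivity
    have hle : min 1 (x⁻¹ ^ 2) ≤ 1 := min_le_left _ _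
    have hpos : 0 < min 1 (x⁻¹ ^ 2) := by positivity
    refine ⟨min 1 (x⁻¹ ^ 2), hpos, ?_⟩
    have h2 := hRl _ 1 hpos hle
    have h3 : x ≤ √(1 / min 1 (x⁻¹ ^ 2)) := by
      refine Real.le_sqrt_of_sq_le ?_
      rw [le_div_iff₀ hpos]
      calc x ^ 2 * min 1 (x⁻¹ ^ 2) ≤ x ^ 2 * x⁻¹ ^ 2 := by gcongr; exact min_le_right _ _
        _ = 1 := by field_simp
    have h4 := (mul_le_mul_of_nonneg_right h3 (h.rhoReal_pos hpos).le).trans h2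
    rw [hx, div_mul_eq_mul_div, div_le_iff₀ hu] at h4
    exact le_of_mul_le_mul_left h4 (by positivity)
  have hbdd : BddAbove S := by
    refine ⟨max 1 ((R * u / rhoReal r b q a 1) ^ 2), fun t ht => ?_⟩
    rcases le_total t 1 with h2 | h2
    · exact h2.trans (le_max_left _ _)
    refine le_trans ?_ (le_max_right _ _)
    have h3 := hRl 1 t one_pos h2
    rw [div_one] at h3
    refine (Real.sqrt_le_left (by positivity)).1 ?_
    rw [le_div_iff₀ h1]
    exact h3.trans (mul_le_mul_of_nonneg_left ht.2 hR.le)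
  have hT : 0 < sSup S := by
    obtain ⟨t, ht⟩ := hne
    exact ht.1.trans_le (le_csSup hbdd ht)
  -- Every t in (T, 2T) is less than 4t₁, so the linear growth bound of ρ yields ρ(t) ≤ 4u.
  obtain ⟨t₁, ht₁, hlt⟩ := exists_lt_of_lt_csSup hne (half_lt_self hT)
  refine ⟨sSup S, hT, fun t ht => ⟨?_, ?_⟩⟩
  · by_contra hcon
    exact ht.1.not_ge (le_csSup hbdd ⟨hT.trans ht.1, (not_le.1 hcon).le⟩)
  · have h2 := h.rhoReal_le ht₁.1 ((le_csSup hbdd ht₁).trans ht.1.le)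
    refine h2.trans (mul_le_mul ?_ ht₁.2 (h.rhoReal_pos ht₁.1).le (by norm_num))
    rw [div_le_iff₀ ht₁.1]
    linarith [ht.2]

/-- Change of variables `u = ρ(t)` for functions of bounded logarithmic oscillation. -/
theorem exists_logNorm_comp_rhoReal {s : ℝ≥0∞} (hs : 0 < s) : ∃ C : ℝ≥0,
    ∀ (c : ℝ≥0) (G : ℝ → ℝ≥0∞), Measurable G →
      (∀ x y, 0 < x → 0 < y → x ≤ 4 * y → y ≤ 4 * x → G x ≤ c * G y) →
      logNorm s (Ioi 0) G ≤ C * c * logNorm s (Ioi 0) (fun t => G (rhoReal r b q a t)) ∧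
      logNorm s (Ioi 0) (fun t => G (rhoReal r b q a t)) ≤ C * c * logNorm s (Ioi 0) G := by
  obtain ⟨R, hR, hRl⟩ := h.exists_le_rhoReal (ε := 1 / 2) (by norm_num)
  rw [show (1 : ℝ) - 1 / 2 = 1 / 2 by norm_num] at hRl
  simp only [← Real.sqrt_eq_rpow] at hRl
  set Z : Set (ℝ × ℝ) := {z | 0 < z.1 ∧ 0 < z.2 ∧ z.1 ≤ 4 * rhoReal r b q a z.2 ∧
    rhoReal r b q a z.2 ≤ 4 * z.1} with hZ
  have hρm : Measurable (fun z : ℝ × ℝ => rhoReal r b q a z.2) :=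
    measurable_rhoReal.comp measurable_snd
  have hZm : MeasurableSet Z :=
    (measurableSet_lt measurable_const measurable_fst).inter
      ((measurableSet_lt measurable_const measurable_snd).inter
      ((measurableSet_le measurable_fst (hρm.const_mul 4)).inter
        (measurableSet_le hρm (measurable_fst.const_mul 4))))
  have hZm' : MeasurableSet (Prod.swap ⁻¹' Z) := measurable_swap hZm
  have hfin : ∀ x y : ℝ, 0 < x → logMeasure (Icc x y) ≠ ∞ := fun x y hx =>
    (logMeasure_Icc_lt_top hx).ne
  have hfin' : logMeasure (Ioo 1 2) ≠ ∞ :=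
    ((measure_mono Ioo_subset_Icc_self).trans_lt (logMeasure_Icc_lt_top one_pos)).ne
  have hpos : logMeasure (Ioo 1 2) ≠ 0 := (logMeasure_Ioo_pos (by norm_num) (by norm_num)).ne'
  have hlow₁ : ∀ u, 0 < u → logMeasure (Ioo 1 2) ≤ logMeasure {t | (u, t) ∈ Z} := fun u hu => by
    obtain ⟨T, hT, hTl⟩ := h.exists_rhoReal_near hu
    rw [← logMeasure_Ioo_mul hT, mul_one, mul_comm]
    refine measure_mono fun t ht => ⟨hu, hT.trans ht.1, ?_, (hTl t ht).2⟩
    have := (hTl t ht).1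
    linarith
  have hlow₂ : ∀ t, 0 < t → logMeasure (Ioo 1 2) ≤ logMeasure {u | (u, t) ∈ Z} := fun t ht => by
    have hρ := h.rhoReal_pos ht
    rw [← logMeasure_Ioo_mul hρ, mul_one]
    refine measure_mono fun u hu => ⟨hρ.trans hu.1, ht, ?_, ?_⟩
    · have := hu.2; linarith
    · have := hu.1; change rhoReal r b q a t ≤ 4 * u; linarith
  have hup₂ : ∀ t, 0 < t → logMeasure {u | (u, t) ∈ Z} ≤ logMeasure (Icc (1 / 4) 4) :=
    fun t ht => by
    rw [← logMeasure_Icc_mul (h.rhoReal_pos ht)]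
    refine measure_mono fun u hu => ⟨?_, ?_⟩
    · have := hu.2.2.2; simp only at this; linarith
    · have := hu.2.2.1; simp only at this; linarith
  -- Two points s ≤ t related to the same u satisfy ρ(t) ≤ 16 ρ(s), while √(t/s) ρ(s) ≤ R ρ(t);
  -- hence t/s ≤ (16R)².
  set L := (R * 16) ^ 2 with hL
  have hL0 : 0 < L := by positivity
  have hcmp : ∀ u s t, (u, s) ∈ Z → (u, t) ∈ Z → t ≤ L * s := fun u s t hs ht => by
    have hs0 : 0 < s := hs.2.1
    have ht0 : 0 < t := ht.2.1
    have hρs := h.rhoReal_pos hs0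
    have h1 : rhoReal r b q a t ≤ 16 * rhoReal r b q a s := by
      have h2 := ht.2.2.2
      have h3 := hs.2.2.1
      simp only at h2 h3
      linarith
    rcases le_total t s with hts | hst
    · have h2 := hRl t s ht0 hts
      have hl : 1 ≤ L := by
        have h3 := hRl 1 1 one_pos le_rfl
        have h4 := h.rhoReal_pos one_pos
        simp only [div_one, Real.sqrt_one, one_mul] at h3
        have h5 : 1 ≤ R := by
          by_contra hR1
          nlinarith
        rw [hL]; nlinarith
      nlinarith
    · have h2 := (hRl s t hs0 hst).trans (mul_le_mul_of_nonneg_left h1 hR.le)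
      rw [← mul_assoc] at h2
      have h3 := le_of_mul_le_mul_right h2 hρs
      have h4 := (Real.sqrt_le_left (by positivity)).1 h3
      rwa [div_le_iff₀ hs0] at h4
  have hup₁ : ∀ u, 0 < u → logMeasure {t | (u, t) ∈ Z} ≤ logMeasure (Icc L⁻¹ L) :=
    fun u _ => by
    rcases {t | (u, t) ∈ Z}.eq_empty_or_nonempty with he | ⟨t₀, ht₀⟩
    · rw [he, measure_empty]; exact bot_le
    · have h0 : 0 < t₀ := ht₀.2.1
      rw [← logMeasure_Icc_mul h0]
      refine measure_mono fun t ht => ⟨?_, ?_⟩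
      · rw [mul_inv_le_iff₀ hL0, mul_comm]; exact hcmp u t t₀ ht ht₀
      · rw [mul_comm]; exact hcmp u t₀ t ht₀ ht
  obtain ⟨C, hC⟩ := exists_logNorm_le_of_slices hs hZm hpos hfin' (hfin (1 / 4) 4 (by norm_num))
    hlow₁ hup₂
  obtain ⟨D, hD⟩ := exists_logNorm_le_of_slices hs hZm' hpos hfin' (hfin L⁻¹ L (by positivity))
    hlow₂ hup₁
  refine ⟨max C D, fun c G hG hosc => ⟨?_, ?_⟩⟩
  · refine (hC c G (fun t => G (rhoReal r b q a t)) (hG.comp measurable_rhoReal) fun u t hz => ?_).trans ?_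
    · exact hosc _ _ hz.1 (h.rhoReal_pos hz.2.1) hz.2.2.1 hz.2.2.2
    · gcongr; exact le_max_left _ _
  · refine (hD c _ G hG fun t u hz => ?_).trans ?_
    · exact hosc _ _ (h.rhoReal_pos hz.2.1) hz.1 hz.2.2.2 hz.2.2.1
    · gcongr; exact le_max_right _ _

end LimitData

/-- A Hardy type inequality for functions of bounded logarithmic oscillation. -/
theorem exists_logNorm_le_of_forall_le {s : ℝ≥0∞} (hs : 0 < s) {δ : ℝ} (hδ : 0 < δ) :
    ∃ C : ℝ≥0, ∀ (c A : ℝ≥0) (H Y : ℝ → ℝ≥0∞), Measurable H →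
      (∀ u v, 0 < v → v ≤ u → u ≤ 2 * v → H u ≤ c * H v) →
      (∀ (S : ℝ≥0∞) t, 0 < t → (∀ u, t < u → H u ≤ S * ENNReal.ofReal ((u / t) ^ δ)) →
        Y t ≤ A * S) →
      logNorm s (Ioi 0) Y ≤ A * (C * c) * logNorm s (Ioi 0) H := by
  rcases eq_or_ne s ∞ with rfl | hs'
  · refine ⟨1, fun c A H Y hH hosc hY => ?_⟩
    rw [ENNReal.coe_one, one_mul, logNorm_Ioi_zero _ Y, eLpNorm_exponent_top]
    refine essSup_le_of_ae_le _ ?_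
    filter_upwards [ae_pos_logMeasure] with t ht
    rw [enorm_eq_self, mul_assoc]
    refine hY _ t ht fun u hu => ?_
    have hu0 : 0 < u := ht.trans hu
    have h1 : H u ≤ c * logNorm ∞ (Ioi 0) H :=
      le_logNorm_top_of_slice (Z := Ioo (u / 2) u)
        (logMeasure_Ioo_pos (by positivity) (by linarith)).ne' fun v hv =>
        hosc u v (by linarith [hv.1]) hv.2.le (by linarith [hv.1])
    refine h1.trans (le_mul_of_one_le_right' (ENNReal.one_le_ofReal.2 ?_))
    exact Real.one_le_rpow ((one_le_div₀ ht).2 hu.le) hδ.le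
  set p := s.toReal with hp
  have hp0 : 0 < p := ENNReal.toReal_pos hs.ne' hs'
  set d : ℝ≥0∞ := ENNReal.ofReal (2 ^ (-δ)) ^ p with hd
  have hd1 : d < 1 := ENNReal.rpow_lt_one (ENNReal.ofReal_lt_one.2
    (Real.rpow_lt_one_of_one_lt_of_neg one_lt_two (by linarith))) hp0
  have hfin : ((1 - d)⁻¹) ^ (1 / p) ≠ ∞ :=
    ENNReal.rpow_ne_top_of_nonneg (by positivity)
      (ENNReal.inv_ne_top.2 (tsub_pos_of_lt hd1).ne')
  refine ⟨((1 - d)⁻¹ ^ (1 / p)).toNNReal, fun c A H Y hH hosc hY => ?_⟩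
  -- A dyadic majorant: up to c it dominates H(u)(u/t)^(-δ) for u > t. Dilation invariance gives
  -- every summand the integral of H^p times d^k, a geometric series; no triangle inequality is
  -- used, so p < 1 is allowed.
  set S : ℝ → ℝ≥0∞ := fun t => (∑' k : ℕ, d ^ k * H (2 ^ k * t) ^ p) ^ (1 / p) with hS
  have h1 : ∀ t, 0 < t → ∀ u, t < u → H u ≤ c * S t * ENNReal.ofReal ((u / t) ^ δ) := by
    intro t ht u hu
    obtain ⟨k, hk1, hk2⟩ := exists_nat_pow_near ((one_le_div₀ ht).2 hu.le) one_lt_two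
    have h2 : H u ≤ c * H (2 ^ k * t) := by
      refine hosc u _ (by positivity) ((le_div_iff₀ ht).1 hk1) ?_
      rw [div_lt_iff₀ ht] at hk2
      rw [← mul_assoc, ← pow_succ']
      exact hk2.le
    have h3 : ENNReal.ofReal (2 ^ (-δ)) ^ k * H (2 ^ k * t) ≤ S t := by
      have h4 : d ^ k * H (2 ^ k * t) ^ p ≤ ∑' k : ℕ, d ^ k * H (2 ^ k * t) ^ p :=
        ENNReal.le_tsum k
      have h5 := ENNReal.rpow_le_rpow h4 (show 0 ≤ 1 / p by positivity)
      refine le_trans (le_of_eq ?_) h5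
      rw [ENNReal.mul_rpow_of_nonneg _ _ (by positivity), ← ENNReal.rpow_mul (H _),
        mul_one_div_cancel hp0.ne', ENNReal.rpow_one, hd, ← ENNReal.rpow_natCast,
        ← ENNReal.rpow_natCast, ← ENNReal.rpow_mul, ← ENNReal.rpow_mul]
      congr 2
      field_simp
    have h6 : ENNReal.ofReal (2 ^ (-δ)) ^ k * ENNReal.ofReal ((2 ^ k) ^ δ) = 1 := by
      rw [← ENNReal.ofReal_pow (by positivity), ← ENNReal.ofReal_mul (by positivity),
        ← Real.rpow_natCast, ← Real.rpow_natCast, ← Real.rpow_mul (by norm_num),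
        ← Real.rpow_mul (by norm_num), ← Real.rpow_add (by norm_num)]
      ring_nf
      simp
    calc H u ≤ c * H (2 ^ k * t) := h2
      _ = c * (ENNReal.ofReal (2 ^ (-δ)) ^ k * H (2 ^ k * t)) * ENNReal.ofReal ((2 ^ k) ^ δ) := by
          rw [mul_assoc, mul_right_comm, h6, one_mul]
      _ ≤ c * S t * ENNReal.ofReal ((u / t) ^ δ) := by gcongr
  have h2 : logNorm s (Ioi 0) Y ≤ (A * c : ℝ≥0) * logNorm s (Ioi 0) S := by
    refine logNorm_le_mul measurableSet_Ioi fun t _ ht => ?_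
    rw [ENNReal.coe_mul, mul_assoc]
    exact hY _ t ht (h1 t ht)
  have h3 : ∀ k : ℕ, ∫⁻ t, H (2 ^ k * t) ^ p ∂logMeasure = ∫⁻ t, H t ^ p ∂logMeasure := fun k => by
    have h4 : (0 : ℝ) < 2 ^ k := by positivity
    conv_rhs => rw [← map_mul_left_logMeasure h4]
    rw [lintegral_map (hH.pow_const p) (by fun_prop)]
  have h4 : logNorm s (Ioi 0) S = (1 - d)⁻¹ ^ (1 / p) * logNorm s (Ioi 0) H := by
    rw [logNorm_Ioi_zero, logNorm_Ioi_zero, eLpNorm_eq_lintegral_rpow_enorm_toReal hs.ne' hs',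
      eLpNorm_eq_lintegral_rpow_enorm_toReal hs.ne' hs', ← hp,
      ← ENNReal.mul_rpow_of_nonneg _ _ (by positivity)]
    congr 1
    simp only [enorm_eq_self, hS, ← ENNReal.rpow_mul, one_div_mul_cancel hp0.ne',
      ENNReal.rpow_one]
    have hm : ∀ k : ℕ, AEMeasurable (fun t => d ^ k * H (2 ^ k * t) ^ p) logMeasure := fun k =>
      (((hH.comp (measurable_const_mul _)).pow_const p).const_mul _).aemeasurable
    rw [lintegral_tsum hm]
    have h5 : ∀ k : ℕ, ∫⁻ t, d ^ k * H (2 ^ k * t) ^ p ∂logMeasure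
        = d ^ k * ∫⁻ t, H t ^ p ∂logMeasure := fun k => by
      rw [lintegral_const_mul' _ _ (ENNReal.pow_ne_top (hd1.trans ENNReal.one_lt_top).ne), h3]
    simp_rw [h5]
    rw [ENNReal.tsum_mul_right, ENNReal.tsum_geometric]
  rw [h4] at h2
  refine h2.trans (le_of_eq ?_)
  rw [ENNReal.coe_toNNReal hfin]
  push_cast
  ring

end RealInterp

namespace RealInterp

/-! ### Norms with equivalent weights -/

theorem HasSlowGrowth.exists_rpow_mul_le {α : ℝ → ℝ} (hα : HasSlowGrowth α) (σ : ℝ) {M : ℝ}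
    (hM : 0 < M) : ∃ C : ℝ, 0 < C ∧ ∀ x y, 0 < x → 0 < y → x ≤ M * y → y ≤ M * x →
      x ^ σ * α x ≤ C * (y ^ σ * α y) := by
  obtain ⟨C, hC, h⟩ := hα.growth 1 one_pos
  refine ⟨(M ^ σ + M ^ (-σ)) * (C * M), by positivity, fun x y hx hy hxy hyx => ?_⟩
  have hαy := hα.pos y hy
  have h1 : α x ≤ C * M * α y := by
    rcases le_total x y with hle | hle
    · refine (h x y hx hle).2.trans ?_
      rw [Real.rpow_one]
      gcongr
      rwa [div_le_iff₀ hx]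
    · refine (h y x hy hle).1.trans ?_
      rw [Real.rpow_one]
      gcongr
      rwa [div_le_iff₀ hy]
  have h2 : x ^ σ ≤ (M ^ σ + M ^ (-σ)) * y ^ σ := by
    have hp1 : 0 < M ^ σ := by positivity
    have hp2 : 0 < M ^ (-σ) := by positivity
    have hp3 : 0 < y ^ σ := by positivity
    rcases le_total 0 σ with hσ | hσ
    · calc x ^ σ ≤ (M * y) ^ σ := by gcongr
        _ = M ^ σ * y ^ σ := Real.mul_rpow hM.le hy.le
        _ ≤ _ := by gcongr; linarith
    · calc x ^ σ ≤ (M⁻¹ * y) ^ σ := by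
            refine Real.rpow_le_rpow_of_nonpos (by positivity) ?_ hσ
            rwa [inv_mul_le_iff₀ hM]
        _ = M ^ (-σ) * y ^ σ := by
            rw [Real.mul_rpow (by positivity) hy.le, Real.inv_rpow hM.le, Real.rpow_neg hM.le]
        _ ≤ _ := by gcongr; linarith
  have := hα.pos x hx
  calc x ^ σ * α x ≤ ((M ^ σ + M ^ (-σ)) * y ^ σ) * (C * M * α y) := by gcongr
    _ = _ := by ring

theorem logNorm_weight_le {s : ℝ≥0∞} {E : Set ℝ} (hE : MeasurableSet E) {w w' : ℝ → ℝ} {C : ℝ}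
    (hC : 0 ≤ C) (h : ∀ t, 0 < t → w t ≤ C * w' t) (F : ℝ → ℝ≥0∞) :
    logNorm s E (fun t => ENNReal.ofReal (w t) * F t)
      ≤ C.toNNReal * logNorm s E (fun t => ENNReal.ofReal (w' t) * F t) := by
  refine logNorm_le_mul hE fun t _ ht => ?_
  change _ ≤ ENNReal.ofReal C * _
  rw [← mul_assoc, ← ENNReal.ofReal_mul hC]
  gcongr
  exact h t ht

theorem SameSpace.of_le {V : Type*} {NX NY : V → ℝ≥0∞} {C D : ℝ≥0}
    (h₁ : ∀ f, NX f ≤ C * NY f) (h₂ : ∀ f, NY f ≤ D * NX f) : SameSpace NX NY :=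
  ⟨⟨D, fun f _ => h₂ f⟩, ⟨C, fun f _ => h₁ f⟩⟩

/-! ### The main part and the tail part of the norm. -/

section Spaces

variable {𝕜 V : Type*} [RCLike 𝕜] [AddCommGroup V] {N₀ N₁ : V → ℝ≥0∞}
  {r q s : ℝ≥0∞} {b a α : ℝ → ℝ} {θ : ℝ}

theorem stdNorm_eq_logNorm (hs : 0 < s) (f : V) :
    stdNorm N₀ N₁ θ s α f =
      logNorm s (Ioi 0) (fun u => ENNReal.ofReal (u ^ (-θ) * α u) * peetreK N₀ N₁ u f) :=
  wNorm_eq_logNorm hs _ measurableSet_Ioi subset_rfl _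

/-- The weighted norm of the `K`-functional in the description of the space with parameter `θ`
of the couple `(A₀, A₁^L)`. -/
noncomputable def mainPart (N₀ N₁ : V → ℝ≥0∞) (θ : ℝ) (s : ℝ≥0∞) (α ρ : ℝ → ℝ) (f : V) : ℝ≥0∞ :=
  logNorm s (Ioi 0) (fun t => ENNReal.ofReal (ρ t ^ (-θ) * α (ρ t)) * peetreK N₀ N₁ t f)

/-- The weighted norm of the tails of the limiting functional in the description of the space
with parameter `θ` of the couple `(A₀, A₁^L)`. -/
noncomputable def tailPart (N₀ N₁ : V → ℝ≥0∞) (θ : ℝ) (s : ℝ≥0∞) (α ρ : ℝ → ℝ) (r : ℝ≥0∞)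
    (b : ℝ → ℝ) (q : ℝ≥0∞) (a : ℝ → ℝ) (f : V) : ℝ≥0∞ :=
  logNorm s (Ioi 0) (fun t => ENNReal.ofReal (ρ t ^ (-θ) * α (ρ t)) *
    (ENNReal.ofReal (ρ t) * limTail r b q a (fun u => peetreK N₀ N₁ u f) t))

theorem LimitData.extLRNorm_eq (h : LimitData r b q a) (hs : 0 < s) (c : ℝ → ℝ) (f : V) :
    extLRNorm N₀ N₁ 1 s c r b q a f = logNorm s (Ioi 0) (fun t => ENNReal.ofReal (c t) *
      limTail r b q a (fun u => peetreK N₀ N₁ u f) t) := by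
  rw [extLRNorm, wNorm_eq_logNorm hs _ measurableSet_Ioi subset_rfl]
  refine logNorm_congr measurableSet_Ioi fun t _ ht => ?_
  rw [wNorm_eq_logNorm h.r_pos _ measurableSet_Ioi (Ioi_subset_Ioi ht.le), limTail,
    Real.rpow_zero, one_mul]
  congr 1
  refine logNorm_congr measurableSet_Ioi fun u _ _ => ?_
  rw [wNorm_eq_logNorm h.q_pos _ measurableSet_Ioo
    (Ioo_subset_Ioi_self.trans (Ioi_subset_Ioi ht.le)), Real.rpow_zero, one_mul]
  simp only [Real.rpow_neg_one]

/-- For θ = 1 the factor ρ^(-1) of the weight cancels the ρ in front of the tail. -/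
theorem LimitData.tailPart_one (h : LimitData r b q a) (f : V) :
    tailPart N₀ N₁ 1 s α (rhoReal r b q a) r b q a f = logNorm s (Ioi 0) (fun t =>
      ENNReal.ofReal (α (rhoReal r b q a t)) *
        limTail r b q a (fun u => peetreK N₀ N₁ u f) t) := by
  refine logNorm_congr measurableSet_Ioi fun t _ ht => ?_
  have hρ := h.rhoReal_pos ht
  rw [← mul_assoc, mul_comm (ENNReal.ofReal (_ * _)), ← ENNReal.ofReal_mul hρ.le,
    Real.rpow_neg_one, mul_inv_cancel_left₀ hρ.ne']

theorem exists_stdNorm_le_of_equivPos (hs : 0 < s) {α β : ℝ → ℝ} (h : EquivPos α β) :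
    ∃ C : ℝ≥0, ∀ (N₀ N₁ : V → ℝ≥0∞) (f : V),
      stdNorm N₀ N₁ θ s α f ≤ C * stdNorm N₀ N₁ θ s β f ∧
      stdNorm N₀ N₁ θ s β f ≤ C * stdNorm N₀ N₁ θ s α f := by
  obtain ⟨C, hC, h⟩ := h
  refine ⟨C.toNNReal, fun N₀ N₁ f => ?_⟩
  rw [stdNorm_eq_logNorm hs, stdNorm_eq_logNorm hs]
  refine ⟨logNorm_weight_le measurableSet_Ioi hC.le (fun t ht => ?_) _,
    logNorm_weight_le measurableSet_Ioi hC.le (fun t ht => ?_) _⟩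
  · rw [mul_left_comm]; gcongr; exact (h t ht).1
  · rw [mul_left_comm]; gcongr; exact (h t ht).2

/-- Replacing `χ` by its regularization changes `ρ` only by bounded factors. -/
theorem LimitData.rhoReal_equiv_rhoFun (h : LimitData r b q a) :
    EquivPos (rhoReal r b q a) (rhoFun r b q a) := by
  obtain ⟨C, hC, he⟩ := h.chiReal_equiv_chiFun
  refine ⟨C, hC, fun t ht => ?_⟩
  have h1 := h.chiReal_pos ht
  have h2 := h.chiFun_pos ht
  obtain ⟨h3, h4⟩ := he t ht
  rw [rhoReal, rhoFun, ← mul_div_assoc, ← mul_div_assoc, div_le_div_iff₀ h1 h2,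
    div_le_div_iff₀ h2 h1]
  constructor <;> nlinarith

theorem LimitData.rhoFun_pos (h : LimitData r b q a) {t : ℝ} (ht : 0 < t) :
    0 < rhoFun r b q a t :=
  div_pos ht (h.chiFun_pos ht)

theorem LimitData.equivPos_rpow_mul_comp_rho (h : LimitData r b q a) {α β : ℝ → ℝ}
    (hβ : HasSlowGrowth β) (he : EquivPos α β) (σ : ℝ) :
    EquivPos (fun t => rhoFun r b q a t ^ σ * α (rhoFun r b q a t))
      (fun t => rhoReal r b q a t ^ σ * β (rhoReal r b q a t)) := by
  obtain ⟨M, hM, hρ⟩ := h.rhoReal_equiv_rhoFun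
  obtain ⟨C, hC, hCl⟩ := hβ.exists_rpow_mul_le σ hM
  obtain ⟨D, hD, he⟩ := he
  refine ⟨D * C, by positivity, fun t ht => ?_⟩
  have h1 := h.rhoReal_pos ht
  have h2 := h.rhoFun_pos ht
  have h3 := hρ t ht
  constructor
  · calc rhoFun r b q a t ^ σ * α (rhoFun r b q a t)
        ≤ rhoFun r b q a t ^ σ * (D * β (rhoFun r b q a t)) := by
          gcongr; exact (he _ h2).1
      _ = D * (rhoFun r b q a t ^ σ * β (rhoFun r b q a t)) := by ring
      _ ≤ D * (C * (rhoReal r b q a t ^ σ * β (rhoReal r b q a t))) := by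
          exact mul_le_mul_of_nonneg_left (hCl _ _ h2 h1 h3.2 h3.1) hD.le
      _ = _ := by ring
  · calc rhoReal r b q a t ^ σ * β (rhoReal r b q a t)
        ≤ C * (rhoFun r b q a t ^ σ * β (rhoFun r b q a t)) := hCl _ _ h1 h2 h3.1 h3.2
      _ ≤ C * (rhoFun r b q a t ^ σ * (D * α (rhoFun r b q a t))) := by
          gcongr; exact (he _ h2).2
      _ = _ := by ring

theorem LimitData.exists_mainPart_equiv (h : LimitData r b q a) (hs : 0 < s) {β w : ℝ → ℝ}
    (hα : HasSlowGrowth α) (he : EquivPos β α)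
    (hw : ∀ t, 0 < t → t ^ (-θ) * w t = rhoFun r b q a t ^ (-θ) * β (rhoFun r b q a t)) :
    ∃ C : ℝ≥0, ∀ f : V,
      stdNorm N₀ N₁ θ s w f ≤ C * mainPart N₀ N₁ θ s α (rhoReal r b q a) f ∧
      mainPart N₀ N₁ θ s α (rhoReal r b q a) f ≤ C * stdNorm N₀ N₁ θ s w f := by
  obtain ⟨C, hC, hCl⟩ := h.equivPos_rpow_mul_comp_rho hα he (-θ)
  refine ⟨C.toNNReal, fun f => ?_⟩
  rw [stdNorm_eq_logNorm hs, mainPart]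
  refine ⟨logNorm_weight_le measurableSet_Ioi hC.le (fun t ht => ?_) _,
    logNorm_weight_le measurableSet_Ioi hC.le (fun t ht => ?_) _⟩
  · rw [hw t ht]; exact (hCl t ht).1
  · rw [hw t ht]; exact (hCl t ht).2

theorem LimitData.exists_tailPart_equiv (h : LimitData r b q a) (hs : 0 < s) {β : ℝ → ℝ}
    (hα : HasSlowGrowth α) (he : EquivPos β α) :
    ∃ C : ℝ≥0, ∀ f : V,
      extLRNorm N₀ N₁ 1 s (fun t => β (rhoFun r b q a t)) r b q a f
        ≤ C * tailPart N₀ N₁ 1 s α (rhoReal r b q a) r b q a f ∧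
      tailPart N₀ N₁ 1 s α (rhoReal r b q a) r b q a f
        ≤ C * extLRNorm N₀ N₁ 1 s (fun t => β (rhoFun r b q a t)) r b q a f := by
  obtain ⟨C, hC, hCl⟩ := h.equivPos_rpow_mul_comp_rho hα he 0
  simp only [Real.rpow_zero, one_mul] at hCl
  refine ⟨C.toNNReal, fun f => ?_⟩
  rw [h.extLRNorm_eq hs, h.tailPart_one]
  exact ⟨logNorm_weight_le measurableSet_Ioi hC.le (fun t ht => (hCl t ht).1) _,
    logNorm_weight_le measurableSet_Ioi hC.le (fun t ht => (hCl t ht).2) _⟩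

/-- The oscillation of the weighted `K`-functional. -/
theorem HasSlowGrowth.exists_weight_mul_peetreK_le (hα : HasSlowGrowth α) (σ : ℝ) :
    ∃ C : ℝ≥0, ∀ (N₀ N₁ : V → ℝ≥0∞) (f : V) (x y : ℝ), 0 < x → 0 < y → x ≤ 4 * y → y ≤ 4 * x →
      ENNReal.ofReal (x ^ σ * α x) * peetreK N₀ N₁ x f
        ≤ C * (ENNReal.ofReal (y ^ σ * α y) * peetreK N₀ N₁ y f) := by
  obtain ⟨C, hC, hCl⟩ := hα.exists_rpow_mul_le σ (M := 4) (by norm_num)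
  refine ⟨C.toNNReal * (4 : ℝ).toNNReal, fun N₀ N₁ f x y hx hy hxy hyx => ?_⟩
  have h1 := peetreK_le_mul (N₀ := N₀) (N₁ := N₁) (by norm_num : (1 : ℝ) ≤ 4) hxy f
  have h2 := ENNReal.ofReal_le_ofReal (hCl x y hx hy hxy hyx)
  rw [ENNReal.ofReal_mul hC.le] at h2
  refine (mul_le_mul' h2 h1).trans (le_of_eq ?_)
  simp only [ENNReal.ofReal]
  push_cast
  ring

theorem measurable_rho_weight (hα : Measurable α) (σ : ℝ) :
    Measurable (fun t => ENNReal.ofReal (rhoReal r b q a t ^ σ * α (rhoReal r b q a t))) :=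
  ((measurable_rhoReal.pow_const σ).mul (hα.comp measurable_rhoReal)).ennreal_ofReal

/-- A positive power times a slowly varying function of `ρ` grows at least like a power. -/
theorem LimitData.exists_rho_rpow_mul_le (h : LimitData r b q a) (hα : HasSlowGrowth α) {σ : ℝ}
    (hσ : 0 < σ) : ∃ C : ℝ, 0 < C ∧ ∀ t u, 0 < t → t ≤ u →
      rhoReal r b q a t ^ σ * α (rhoReal r b q a t) ≤
        C * (t / u) ^ (σ / 4) * (rhoReal r b q a u ^ σ * α (rhoReal r b q a u)) := by
  obtain ⟨R, hR, hRl⟩ := h.exists_le_rhoReal (ε := 1 / 2) (by norm_num)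
  rw [show (1 : ℝ) - 1 / 2 = 1 / 2 by norm_num] at hRl
  obtain ⟨C, hC, hCl⟩ := hα.growth (σ / 2) (by positivity)
  refine ⟨C * (R ^ (σ / 2) + R ^ (3 * σ / 2)), by positivity, fun t u ht htu => ?_⟩
  have hu : 0 < u := ht.trans_le htu
  set x := rhoReal r b q a t with hx
  set y := rhoReal r b q a u with hy
  have hx0 : 0 < x := h.rhoReal_pos ht
  have hy0 : 0 < y := h.rhoReal_pos hu
  have hαx := hα.pos x hx0
  have hαy := hα.pos y hy0
  set τ := t / u with hτ
  have hτ0 : 0 < τ := by positivity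
  have hτ1 : τ ≤ 1 := (div_le_one₀ hu).2 htu
  have hxy : x / y ≤ R * τ ^ (1 / 2 : ℝ) := by
    have h1 := hRl t u ht htu
    have h2 : (u / t) ^ (1 / 2 : ℝ) = (τ ^ (1 / 2 : ℝ))⁻¹ := by
      rw [← Real.inv_rpow hτ0.le, hτ, inv_div]
    rw [h2, ← hx, ← hy, inv_mul_le_iff₀ (by positivity)] at h1
    rw [div_le_iff₀ hy0]
    linarith
  -- ρ need not be monotone, so either of x and y may be the larger. Slow growth with exponent σ/2
  -- leaves κ = 1/2 if x ≤ y and κ = 3/2 otherwise; as x/y ≲ τ^(1/2), both give at least the power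
  -- σ/4 of τ.
  have key : ∀ κ : ℝ, 1 / 2 ≤ κ → x ^ σ * α x ≤ C * (x / y) ^ (κ * σ) * (y ^ σ * α y) →
      x ^ σ * α x ≤ C * R ^ (κ * σ) * τ ^ (σ / 4) * (y ^ σ * α y) := fun κ hκ hle => by
    refine hle.trans ?_
    have h1 : (x / y) ^ (κ * σ) ≤ R ^ (κ * σ) * τ ^ (σ / 4) := by
      calc (x / y) ^ (κ * σ) ≤ (R * τ ^ (1 / 2 : ℝ)) ^ (κ * σ) := by
            gcongr
        _ = R ^ (κ * σ) * τ ^ (1 / 2 * (κ * σ)) := by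
            rw [Real.mul_rpow hR.le (by positivity), ← Real.rpow_mul hτ0.le]
        _ ≤ R ^ (κ * σ) * τ ^ (σ / 4) := by
            refine mul_le_mul_of_nonneg_left ?_ (by positivity)
            exact Real.rpow_le_rpow_of_exponent_ge hτ0 hτ1 (by nlinarith)
    calc C * (x / y) ^ (κ * σ) * (y ^ σ * α y)
        ≤ C * (R ^ (κ * σ) * τ ^ (σ / 4)) * (y ^ σ * α y) := by gcongr
      _ = _ := by ring
  have hxσ : x ^ σ = (x / y) ^ σ * y ^ σ := by
    rw [← Real.mul_rpow (by positivity) hy0.le, div_mul_cancel₀ _ hy0.ne']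
  have hRp : 0 < R ^ (σ / 2) := by positivity
  have hRp' : 0 < R ^ (3 * σ / 2) := by positivity
  rcases le_total x y with hle | hle
  · refine (key (1 / 2) le_rfl ?_).trans ?_
    · calc x ^ σ * α x ≤ x ^ σ * (C * (y / x) ^ (σ / 2) * α y) := by
            gcongr; exact (hCl x y hx0 hle).2
        _ = C * ((x / y) ^ σ * (y / x) ^ (σ / 2)) * (y ^ σ * α y) := by rw [hxσ]; ring
        _ = _ := by
            have h1 : (y / x) ^ (σ / 2) = (x / y) ^ (-(σ / 2)) := by
              rw [Real.rpow_neg (by positivity), ← Real.inv_rpow (by positivity), inv_div]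
            rw [h1, ← Real.rpow_add (by positivity)]
            ring_nf
    · rw [show 1 / 2 * σ = σ / 2 by ring]
      gcongr
      linarith
  · refine (key (3 / 2) (by norm_num) ?_).trans ?_
    · calc x ^ σ * α x ≤ x ^ σ * (C * (x / y) ^ (σ / 2) * α y) := by
            gcongr; exact (hCl y x hy0 hle).1
        _ = C * ((x / y) ^ σ * (x / y) ^ (σ / 2)) * (y ^ σ * α y) := by rw [hxσ]; ring
        _ = _ := by
            rw [← Real.rpow_add (by positivity)]
            ring_nf
    · rw [show 3 / 2 * σ = 3 * σ / 2 by ring]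
      gcongr
      linarith

/-- For `θ < 1` the tails of the limiting functional are dominated by the main part. -/
theorem LimitData.exists_tailPart_le (h : LimitData r b q a) (hs : 0 < s)
    (hα : HasSlowGrowth α) (hαm : Measurable α) (hθ : θ < 1) : ∃ C : ℝ≥0, ∀ f : V,
      tailPart N₀ N₁ θ s α (rhoReal r b q a) r b q a f ≤
        C * mainPart N₀ N₁ θ s α (rhoReal r b q a) f := by
  have hσ : 0 < 1 - θ := by linarith
  -- The gain (t/u)^((1-θ)/4) is split into two factors (t/u)^δ: one offsets the growth (u/t)^δ
  -- allowed in the Hardy inequality, the other is the decay required by `exists_limTail_le`.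
  set δ := (1 - θ) / 8 with hδ
  have hδ0 : 0 < δ := by positivity
  obtain ⟨A, hA, hAl⟩ := h.exists_rho_rpow_mul_le hα hσ
  obtain ⟨L, hL⟩ := h.exists_limTail_le hδ0
  obtain ⟨Hc, hH⟩ := exists_logNorm_le_of_forall_le hs hδ0
  obtain ⟨R, hR, hRl⟩ := h.exists_le_rhoReal (ε := 1) one_pos
  obtain ⟨c, hc0, hc⟩ := hα.exists_rpow_mul_le (-θ) (M := max 2 R) (by positivity)
  refine ⟨L * A.toNNReal * (Hc * (c.toNNReal * (2 : ℝ).toNNReal)), fun f => ?_⟩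
  set ρ := rhoReal r b q a with hρ
  set K := fun t => peetreK N₀ N₁ t f with hK
  have hwm : Measurable (fun t => ENNReal.ofReal (ρ t ^ (-θ) * α (ρ t))) :=
    measurable_rho_weight hαm (-θ)
  have hmain := hH (c.toNNReal * (2 : ℝ).toNNReal) (L * A.toNNReal)
    (fun t => ENNReal.ofReal (ρ t ^ (-θ) * α (ρ t)) * K t)
    (fun t => ENNReal.ofReal (ρ t ^ (-θ) * α (ρ t)) *
      (ENNReal.ofReal (ρ t) * limTail r b q a K t)) (hwm.mul (measurable_peetreK f)) ?_ ?_
  · refine hmain.trans (le_of_eq ?_)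
    push_cast
    rfl
  · intro u v hv hvu hu2
    have hu : 0 < u := hv.trans_le hvu
    have h1 : ρ u ≤ max 2 R * ρ v := by
      refine (h.rhoReal_le hv hvu).trans (mul_le_mul_of_nonneg_right ?_ (h.rhoReal_pos hv).le)
      refine le_trans ?_ (le_max_left _ _)
      rwa [div_le_iff₀ hv]
    have h2 : ρ v ≤ max 2 R * ρ u := by
      have h3 := hRl v u hv hvu
      rw [sub_self, Real.rpow_zero, one_mul] at h3
      exact h3.trans (mul_le_mul_of_nonneg_right (le_max_right _ _) (h.rhoReal_pos hu).le)
    have h3 := ENNReal.ofReal_le_ofReal (hc _ _ (h.rhoReal_pos hu) (h.rhoReal_pos hv) h1 h2)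
    have h4 := peetreK_le_mul (N₀ := N₀) (N₁ := N₁) one_le_two hu2 f
    rw [ENNReal.ofReal_mul hc0.le] at h3
    refine (mul_le_mul' h3 h4).trans (le_of_eq ?_)
    simp only [ENNReal.ofReal, hK]
    push_cast
    ring
  · intro S t ht hS
    have hρt := h.rhoReal_pos ht
    have hαt := hα.pos _ hρt
    set P := ρ t ^ (1 - θ) * α (ρ t) with hP
    have hP0 : 0 < P := by positivity
    have hPw : ∀ v, 0 < v → ρ v ^ (1 - θ) * α (ρ v) = ρ v ^ (-θ) * α (ρ v) * ρ v := fun v hv => by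
      have hρv := h.rhoReal_pos hv
      rw [show 1 - θ = -θ + 1 by ring, Real.rpow_add_one hρv.ne']; ring
    have hK : ∀ u, t < u → K u ≤ S * ENNReal.ofReal (A / P) *
        ENNReal.ofReal ((t / u) ^ δ * ρ u) := fun u hu => by
      have hu0 : 0 < u := ht.trans hu
      have hρu := h.rhoReal_pos hu0
      have hαu := hα.pos _ hρu
      set w := ρ u ^ (-θ) * α (ρ u) with hw
      have hw0 : 0 < w := by positivity
      have h1 := hAl t u ht hu.le
      rw [← hP, hPw u hu0, ← hw] at h1
      have h2 : (t / u) ^ ((1 - θ) / 4) = (t / u) ^ δ * (t / u) ^ δ := by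
        rw [← Real.rpow_add (by positivity), hδ]; ring_nf
      have h3 : (u / t) ^ δ * (t / u) ^ δ = 1 := by
        rw [← Real.mul_rpow (by positivity) (by positivity), div_mul_div_cancel₀ ht.ne',
          div_self hu0.ne', Real.one_rpow]
      have hp1 : 0 < (u / t) ^ δ := by positivity
      have h4 : w⁻¹ * (u / t) ^ δ ≤ A / P * ((t / u) ^ δ * ρ u) := by
        rw [div_mul_eq_mul_div, le_div_iff₀ hP0]
        calc w⁻¹ * (u / t) ^ δ * P
            ≤ w⁻¹ * (u / t) ^ δ * (A * (t / u) ^ ((1 - θ) / 4) * (w * ρ u)) := by gcongr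
          _ = A * ((u / t) ^ δ * (t / u) ^ δ) * (t / u) ^ δ * ρ u * (w⁻¹ * w) := by
              rw [h2]; ring
          _ = _ := by rw [h3, inv_mul_cancel₀ hw0.ne']; ring
      calc K u = ENNReal.ofReal w⁻¹ * (ENNReal.ofReal w * K u) := by
            rw [← mul_assoc, ← ENNReal.ofReal_mul (by positivity), inv_mul_cancel₀ hw0.ne',
              ENNReal.ofReal_one, one_mul]
        _ ≤ ENNReal.ofReal w⁻¹ * (S * ENNReal.ofReal ((u / t) ^ δ)) :=
            mul_le_mul' le_rfl (hS u hu)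
        _ = S * ENNReal.ofReal (w⁻¹ * (u / t) ^ δ) := by
            rw [ENNReal.ofReal_mul (by positivity)]; ring
        _ ≤ S * ENNReal.ofReal (A / P * ((t / u) ^ δ * ρ u)) := by gcongr
        _ = _ := by rw [ENNReal.ofReal_mul (by positivity), mul_assoc]
    have h1 := hL K _ t ht hK
    calc ENNReal.ofReal (ρ t ^ (-θ) * α (ρ t)) * (ENNReal.ofReal (ρ t) * limTail r b q a K t)
        = ENNReal.ofReal P * limTail r b q a K t := by
          rw [← mul_assoc, ← ENNReal.ofReal_mul (by positivity), hP, hPw t ht]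
      _ ≤ ENNReal.ofReal P * (L * (S * ENNReal.ofReal (A / P))) := mul_le_mul' le_rfl h1
      _ = L * S * (ENNReal.ofReal P * ENNReal.ofReal (A / P)) := by ring
      _ = L * S * ENNReal.ofReal A := by
          rw [← ENNReal.ofReal_mul hP0.le, mul_div_cancel₀ _ hP0.ne']
      _ = _ := by
          simp only [ENNReal.ofReal]
          push_cast
          ring

/-! ### The interpolation spaces of the couple of A₀ and the limiting space. -/

variable [Module 𝕜 V] [TopologicalSpace V]

theorem LimitData.exists_stdNorm_limLNorm_equiv (h : LimitData r b q a)
    (hN₀ : IsQuasiBanach 𝕜 N₀) (hN₁ : IsQuasiBanach 𝕜 N₁) (hs : 0 < s)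
    (hα : HasSlowGrowth α) (hαm : Measurable α) (θ : ℝ) : ∃ C : ℝ≥0, ∀ f : V,
      stdNorm N₀ (limLNorm N₀ N₁ 1 r b q a) θ s α f ≤
        C * (mainPart N₀ N₁ θ s α (rhoReal r b q a) f +
          tailPart N₀ N₁ θ s α (rhoReal r b q a) r b q a f) ∧
      mainPart N₀ N₁ θ s α (rhoReal r b q a) f ≤
        C * stdNorm N₀ (limLNorm N₀ N₁ 1 r b q a) θ s α f ∧
      tailPart N₀ N₁ θ s α (rhoReal r b q a) r b q a f ≤
        C * stdNorm N₀ (limLNorm N₀ N₁ 1 r b q a) θ s α f := by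
  obtain ⟨T, hT⟩ := h.exists_logNorm_comp_rhoReal hs
  obtain ⟨c, hc⟩ := hα.exists_weight_mul_peetreK_le (V := V) (-θ)
  obtain ⟨L, hL⟩ := h.exists_le_peetreK_limLNorm hN₀ hN₁
  obtain ⟨U, hU⟩ := h.exists_peetreK_limLNorm_le hN₀ hN₁
  obtain ⟨A, hA⟩ := exists_logNorm_add_le s
  refine ⟨T * c * (U * A + L), fun f => ?_⟩
  set NL := limLNorm N₀ N₁ 1 r b q a
  set ρ := rhoReal r b q a with hρ
  have hGm : Measurable (fun u => ENNReal.ofReal (u ^ (-θ) * α u) * peetreK N₀ NL u f) :=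
    ((measurable_id.pow_const (-θ)).mul hαm).ennreal_ofReal.mul (measurable_peetreK f)
  obtain ⟨h1, h2⟩ := hT c _ hGm (hc N₀ NL f)
  rw [← stdNorm_eq_logNorm hs] at h1 h2
  -- Q is the norm after the substitution u = ρ(t). The upper half of the Holmstedt formula bounds
  -- it by both parts together, and the lower half bounds each part by it.
  set Q := logNorm s (Ioi 0)
    (fun t => ENNReal.ofReal (ρ t ^ (-θ) * α (ρ t)) * peetreK N₀ NL (ρ t) f) with hQ
  have hwm : Measurable (fun t => ENNReal.ofReal (ρ t ^ (-θ) * α (ρ t))) :=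
    measurable_rho_weight hαm (-θ)
  have hupper : Q ≤ U * (A * (mainPart N₀ N₁ θ s α ρ f + tailPart N₀ N₁ θ s α ρ r b q a f)) := by
    refine le_trans (logNorm_le_mul (c := U) measurableSet_Ioi fun t _ ht => ?_)
      (mul_le_mul' le_rfl (hA _ _ _ (hwm.mul (measurable_peetreK f)).aemeasurable
        (hwm.mul (measurable_rhoReal.ennreal_ofReal.mul limTail_anti.measurable)).aemeasurable))
    rw [← mul_add, mul_left_comm]
    exact mul_le_mul' le_rfl (hU t ht f)
  have hmain : mainPart N₀ N₁ θ s α ρ f ≤ L * Q := by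
    refine logNorm_le_mul measurableSet_Ioi fun t _ ht => ?_
    rw [mul_left_comm]
    exact mul_le_mul' le_rfl (le_self_add.trans (hL t ht f))
  have htail : tailPart N₀ N₁ θ s α ρ r b q a f ≤ L * Q := by
    refine logNorm_le_mul measurableSet_Ioi fun t _ ht => ?_
    rw [mul_left_comm (L : ℝ≥0∞)]
    exact mul_le_mul' le_rfl (le_add_self.trans (hL t ht f))
  have hLQ : L * Q ≤ (T * c * (U * A + L) : ℝ≥0) * stdNorm N₀ NL θ s α f := by
    calc L * Q ≤ L * (T * c * stdNorm N₀ NL θ s α f) := mul_le_mul' le_rfl h2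
      _ = T * c * L * stdNorm N₀ NL θ s α f := by ring
      _ ≤ _ := by
        push_cast
        gcongr
        exact le_add_self
  refine ⟨?_, hmain.trans hLQ, htail.trans hLQ⟩
  calc stdNorm N₀ NL θ s α f
      ≤ T * c * (U * (A * (mainPart N₀ N₁ θ s α ρ f + tailPart N₀ N₁ θ s α ρ r b q a f))) :=
        h1.trans (mul_le_mul' le_rfl hupper)
    _ = T * c * (U * A) * (mainPart N₀ N₁ θ s α ρ f + tailPart N₀ N₁ θ s α ρ r b q a f) := by ring
    _ ≤ _ := by
      push_cast
      gcongr
      exact le_self_add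

/-- The case `θ < 1`. -/
theorem LimitData.sameSpace_of_lt_one (h : LimitData r b q a)
    (hN₀ : IsQuasiBanach 𝕜 N₀) (hN₁ : IsQuasiBanach 𝕜 N₁) (hs : 0 < s) {β w : ℝ → ℝ}
    (hβ : IsSlowlyVarying β) (hθ : θ < 1)
    (hw : ∀ t, 0 < t → t ^ (-θ) * w t = rhoFun r b q a t ^ (-θ) * β (rhoFun r b q a t)) :
    SameSpace (stdNorm N₀ (limLNorm N₀ N₁ 1 r b q a) θ s β) (stdNorm N₀ N₁ θ s w) := by
  -- A Borel α makes α∘ρ measurable, which Lebesgue measurability of β alone does not provide.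
  obtain ⟨α, hαm, hα, he⟩ := hβ.exists_measurable
  obtain ⟨C₁, h₁⟩ := exists_stdNorm_le_of_equivPos (V := V) (θ := θ) hs he
  obtain ⟨C₂, h₂⟩ := h.exists_stdNorm_limLNorm_equiv hN₀ hN₁ hs hα hαm θ
  obtain ⟨C₃, h₃⟩ := h.exists_tailPart_le (N₀ := N₀) (N₁ := N₁) hs hα hαm hθ
  obtain ⟨C₄, h₄⟩ := h.exists_mainPart_equiv (N₀ := N₀) (N₁ := N₁) hs hα he hw
  refine SameSpace.of_le (C := C₁ * (C₂ * ((1 + C₃) * C₄))) (D := C₄ * (C₂ * C₁))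
    (fun f => ?_) (fun f => ?_)
  · calc _ ≤ C₁ * (C₂ * (mainPart N₀ N₁ θ s α (rhoReal r b q a) f +
          tailPart N₀ N₁ θ s α (rhoReal r b q a) r b q a f)) :=
          (h₁ _ _ f).1.trans (mul_le_mul' le_rfl (h₂ f).1)
      _ ≤ C₁ * (C₂ * (mainPart N₀ N₁ θ s α (rhoReal r b q a) f +
          C₃ * mainPart N₀ N₁ θ s α (rhoReal r b q a) f)) := by gcongr; exact h₃ f
      _ = C₁ * (C₂ * ((1 + C₃) * mainPart N₀ N₁ θ s α (rhoReal r b q a) f)) := by ring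
      _ ≤ C₁ * (C₂ * ((1 + C₃) * (C₄ * stdNorm N₀ N₁ θ s w f))) := by gcongr; exact (h₄ f).2
      _ = _ := by push_cast; ring
  · calc stdNorm N₀ N₁ θ s w f ≤ C₄ * mainPart N₀ N₁ θ s α (rhoReal r b q a) f := (h₄ f).1
      _ ≤ C₄ * (C₂ * stdNorm N₀ (limLNorm N₀ N₁ 1 r b q a) θ s α f) :=
          mul_le_mul' le_rfl (h₂ f).2.1
      _ ≤ C₄ * (C₂ * (C₁ * stdNorm N₀ (limLNorm N₀ N₁ 1 r b q a) θ s β f)) :=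
          mul_le_mul' le_rfl (mul_le_mul' le_rfl (h₁ _ _ f).2)
      _ = _ := by push_cast; ring

/-- The case `θ = 1`. -/
theorem LimitData.sameSpace_one (h : LimitData r b q a)
    (hN₀ : IsQuasiBanach 𝕜 N₀) (hN₁ : IsQuasiBanach 𝕜 N₁) (hs : 0 < s) {β : ℝ → ℝ}
    (hβ : IsSlowlyVarying β) :
    SameSpace (stdNorm N₀ (limLNorm N₀ N₁ 1 r b q a) 1 s β)
      (interNorm (stdNorm N₀ N₁ 1 s (fun t => chiFun r b q a t * β (rhoFun r b q a t)))
        (extLRNorm N₀ N₁ 1 s (fun t => β (rhoFun r b q a t)) r b q a)) := by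
  obtain ⟨α, hαm, hα, he⟩ := hβ.exists_measurable
  obtain ⟨C₁, h₁⟩ := exists_stdNorm_le_of_equivPos (V := V) (θ := 1) hs he
  obtain ⟨C₂, h₂⟩ := h.exists_stdNorm_limLNorm_equiv hN₀ hN₁ hs hα hαm 1
  obtain ⟨C₃, h₃⟩ := h.exists_tailPart_equiv (N₀ := N₀) (N₁ := N₁) hs hα he
  obtain ⟨C₄, h₄⟩ := h.exists_mainPart_equiv (N₀ := N₀) (N₁ := N₁) (θ := 1)
    (w := fun t => chiFun r b q a t * β (rhoFun r b q a t)) hs hα he fun t ht => by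
      have := h.chiFun_pos ht
      rw [Real.rpow_neg_one, Real.rpow_neg_one]
      nth_rewrite 2 [rhoFun]
      rw [inv_div]
      ring
  refine SameSpace.of_le (C := C₁ * (C₂ * (C₄ + C₃))) (D := (C₄ + C₃) * (C₂ * C₁))
    (fun f => ?_) (fun f => ?_)
  · calc _ ≤ C₁ * (C₂ * (mainPart N₀ N₁ 1 s α (rhoReal r b q a) f +
          tailPart N₀ N₁ 1 s α (rhoReal r b q a) r b q a f)) :=
          (h₁ _ _ f).1.trans (mul_le_mul' le_rfl (h₂ f).1)
      _ ≤ C₁ * (C₂ * (C₄ * interNorm _ _ f + C₃ * interNorm _ _ f)) :=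
          mul_le_mul' le_rfl (mul_le_mul' le_rfl (add_le_add
            ((h₄ f).2.trans (mul_le_mul' le_rfl (le_max_left _ _)))
            ((h₃ f).2.trans (mul_le_mul' le_rfl (le_max_right _ _)))))
      _ = _ := by push_cast; ring
  · have h5 : ∀ x, x ≤ C₂ * stdNorm N₀ (limLNorm N₀ N₁ 1 r b q a) 1 s α f →
        x ≤ C₂ * C₁ * stdNorm N₀ (limLNorm N₀ N₁ 1 r b q a) 1 s β f := fun x hx => by
      rw [mul_assoc]
      exact hx.trans (mul_le_mul' le_rfl (h₁ _ _ f).2)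
    rw [interNorm]
    push_cast
    rw [mul_assoc]
    refine max_le ?_ ?_
    · exact (h₄ f).1.trans (mul_le_mul' le_self_add (h5 _ (h₂ f).2.1))
    · exact (h₃ f).1.trans (mul_le_mul' le_add_self (h5 _ (h₂ f).2.2))

end Spaces

end RealInterp

theorem theorem25 {𝕜 V : Type*} [RCLike 𝕜] [AddCommGroup V] [Module 𝕜 V]
    [TopologicalSpace V] [IsTopologicalAddGroup V] [ContinuousSMul 𝕜 V] [T2Space V]
    (N₀ N₁ : V → ℝ≥0∞)
    (hN₀ : RealInterp.IsQuasiBanach 𝕜 N₀) (hN₁ : RealInterp.IsQuasiBanach 𝕜 N₁)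
    (hinter : ∃ x : V, x ≠ 0 ∧ N₀ x < ∞ ∧ N₁ x < ∞)
    (r₁ q₁ : ℝ≥0∞) (hr₁ : 0 < r₁) (hq₁ : 0 < q₁) (a₁ b₁ : ℝ → ℝ)
    (ha₁ : RealInterp.IsSlowlyVarying a₁) (hb₁ : RealInterp.IsSlowlyVarying b₁)
    (hfin₁ : RealInterp.wNorm 0 r₁ b₁ (Ioi 1) (fun _ => 1) < ∞)
    (hfin₂ : RealInterp.wNorm 0 r₁ b₁ (Ioo 0 1)
      (fun s => RealInterp.wNorm 0 q₁ a₁ (Ioo 0 s) (fun _ => 1)) < ∞)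
    (r : ℝ≥0∞) (hr : 0 < r) (a : ℝ → ℝ) (ha : RealInterp.IsSlowlyVarying a) :
    (∀ θ : ℝ, 0 < θ → θ < 1 →
      RealInterp.SameSpace
        (RealInterp.stdNorm N₀ (RealInterp.limLNorm N₀ N₁ 1 r₁ b₁ q₁ a₁) θ r a)
        (RealInterp.stdNorm N₀ N₁ θ r (fun t =>
          RealInterp.chiFun r₁ b₁ q₁ a₁ t ^ θ * a (RealInterp.rhoFun r₁ b₁ q₁ a₁ t)))) ∧
    (RealInterp.wNorm 0 r a (Ioi 1) (fun _ => 1) < ∞ →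
      RealInterp.SameSpace
        (RealInterp.stdNorm N₀ (RealInterp.limLNorm N₀ N₁ 1 r₁ b₁ q₁ a₁) 0 r a)
        (RealInterp.stdNorm N₀ N₁ 0 r (fun t => a (RealInterp.rhoFun r₁ b₁ q₁ a₁ t)))) ∧
    (RealInterp.wNorm 0 r a (Ioo 0 1) (fun _ => 1) < ∞ →
      RealInterp.SameSpace
        (RealInterp.stdNorm N₀ (RealInterp.limLNorm N₀ N₁ 1 r₁ b₁ q₁ a₁) 1 r a)
        (RealInterp.interNorm
          (RealInterp.stdNorm N₀ N₁ 1 r (fun t =>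
            RealInterp.chiFun r₁ b₁ q₁ a₁ t * a (RealInterp.rhoFun r₁ b₁ q₁ a₁ t)))
          (RealInterp.extLRNorm N₀ N₁ 1 r (fun t => a (RealInterp.rhoFun r₁ b₁ q₁ a₁ t))
            r₁ b₁ q₁ a₁))) := by
  have h : RealInterp.LimitData r₁ b₁ q₁ a₁ := by
    refine ⟨hr₁, hq₁, hb₁, ha₁, ?_, ?_⟩
    · rw [RealInterp.wNorm_eq_logNorm hr₁ _ measurableSet_Ioi (Ioi_subset_Ioi zero_le_one)] at hfin₁
      simpa [RealInterp.tailNorm] using hfin₁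
    · rw [RealInterp.wNorm_eq_logNorm hr₁ _ measurableSet_Ioo Ioo_subset_Ioi_self] at hfin₂
      refine lt_of_eq_of_lt (RealInterp.logNorm_congr measurableSet_Ioo fun s _ _ => ?_) hfin₂
      rw [RealInterp.wNorm_eq_logNorm hq₁ _ measurableSet_Ioo Ioo_subset_Ioi_self]
      simp [RealInterp.headNorm]
  refine ⟨fun θ _ hθ => ?_, fun _ => ?_, fun _ => ?_⟩
  -- The weights match because t^(-θ) χ₁^θ = ρ^(-θ); for θ = 0 both powers are 1.
  · refine h.sameSpace_of_lt_one hN₀ hN₁ hr ha hθ fun t ht => ?_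
    have hχ := h.chiFun_pos ht
    nth_rewrite 2 [RealInterp.rhoFun]
    rw [Real.div_rpow ht.le hχ.le, Real.rpow_neg hχ.le, div_inv_eq_mul]
    ring
  · refine h.sameSpace_of_lt_one hN₀ hN₁ hr ha zero_lt_one fun t _ => ?_
    simp
  · exact h.sameSpace_one hN₀ hN₁ hr ha
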